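/- **Setting.** The vertex set is $\{1,\dots,n\}$, with an arbitrary initial total order, kept in a dynamic ordered list, and no arcs. Arcs $(v,w)$ with $v\ne w$, not yet present, are added one at a time, until an addition creates a cycle. Every vertex $x$ has a singly linked list of its outgoing and one of its incoming arcs; $\mathit{first\text{-}out}(x)$, $\mathit{first\text{-}in}(x)$ are their first arcs, and $<$ is the current order. If $v<w$, the arc is only added to the lists. If $v>w$, the following *soft-threshold search* is run. *Start.* $F=\{w\}$, $B=\{v\}$, $s=v$, $F_P=B_P=\emptyset$, $\mathit{out}(w)=\mathit{first\text{-}out}(w)$, $\mathit{in}(v)=\mathit{first\text{-}in}(v)$; $F_A=\{w\}$ if $\mathit{out}(w)\neq$ null, else $\emptyset$; $B_A=\{v\}$ if $\mathit{in}(v)\ne$ null, else $\emptyset$. *Loop.* While $F_A\neq\emptyset$ and $B_A\neq\emptyset$, choose arbitrary $u\in F_A$, $z\in B_A$ and do (a), (b), (c). (a) If $u<z$, let $(u,x)=\mathit{out}(u)$, $(y,z)=\mathit{in}(z)$, and advance both pointers along their lists; remove $u$ from $F_A$ (resp. $z$ from $B_A$) if its pointer becomes null. If $x\in B$, report a cycle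 and return $(u,x)$. Otherwise, if $y\in F\cup\{x\}$, report a cycle and return $(y,z)$. Otherwise, if $x\notin F$, put $x$ into $F$, set $\mathit{out}(x)=\mathit{first\text{-}out}(x)$, and put $x$ into $F_A$ if this is not null; if $y\notin B$, treat $y$ symmetrically with $B$, $\mathit{in}$, $B_A$. If $u\not<z$, then move $u$ from $F_A$ to $F_P$ if $u>s$, and move $z$ from $B_A$ to $B_P$ if $z<s$. (b) If $F_A=\emptyset$: set $B_P=\emptyset$, remove $s$ from $B_A$, and if $F_P\ne\emptyset$ select a new $s\in F_P$ and move all $x\in F_P$ with $x\le s$ from $F_P$ to $F_A$. (c) If $B_A=\emptyset$: set $F_P=\emptyset$, remove $s$ from $F_A$, and if $B_P\neq\emptyset$ select a new $s\in B_P$ and move all $x\in B_P$ with $x\ge s$ from $B_P$ to $B_A$. *Reordering.* If the loop ends without a report, let $t=\min(\{v\}\cup\{x\in F:\mathit{out}(x)\ne\text{null}\})$, $F_<=\{x\in F: x<t\}$, $B_>=\{y\in B:y>t\}$. Sort $F_<$ and $B_>$ topologically (repeated deletion of sources, along outgoing arcs for $F_<$; the mirror image, along incoming arcs, for $B_>$).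 If $t=v$, move $F_<$ just after $t$; otherwise move $F_<$ just before $t$, and $B_>$ just before $F_<$. **Thresholds.** For $0<\varepsilon\le\frac12$, an element $s$ of a set of $k$ candidates is an *$\varepsilon$-approximate median* if at least $\varepsilon k$ candidates are $\le s$ and at least $\varepsilon k$ are $\ge s$; for $\varepsilon=\frac12$ these are exactly the medians. Each new $s$ is selected from the $k=|F_P|$ or $k=|B_P|$ candidates by a comparison-based selection procedure (decision tree) that, for every ordering of $k$ candidates, finds an $\varepsilon$-approximate median with at most $ak$ comparisons. **Time.** One time step is a bounded, loop-free block of elementary operations: pointer, mark and linked-list operations, and the order queries, insertions and deletions of the dynamic ordered list. Scanning, splitting or emptying a list takes one step per element; a selection takes $k$ steps plus the number of comparisons actually made; topological sorting takes one step for each vertex and arc handled in each of its passes; a vertex is moved by one deletion and one insertion. No heaps are used. Building the initial structure is not counted. **Theorem.** There is $a_0\in\mathbb N$ such that for every $k\ge1$ some comparison-based procedure selects a median of $k$ candidates with at most $a_0k$ comparisons, and such that for every $\varepsilon\in(0,\frac12]$ and every integer $a\ge a_0$ there is a constant $C=C(\varepsilon,a)$ for which the following holds for every $n$, every initial order, every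 sequence of arc additions, and all choices made by the algorithm: 1. at every moment the total time used so far is at most $C\,m^{3/2}$, where $m$ is the number of arcs added so far; 2. the algorithm never gets stuck: any new arc can be processed whenever no search is in progress and no cycle has been reported, and a search in progress can always be continued (as each step takes positive time, by 1. every search terminates); 3. whenever no search is in progress and no cycle has been reported, the graph is acyclic and the maintained order is a topological order of it; 4. if a cycle is reported on the addition of $(v,w)$, the returned arc $(x,y)$ is an arc added before $(v,w)$, and earlier arcs form a path from $w$ to $x$ and a path from $y$ to $v$, so that $(x,y)$ and $(v,w)$ lie on a common cycle. In particular, with medians (or $\varepsilon$-approximate medians for a fixed $\varepsilon>0$) found by linear-time selection, soft-threshold search handles $m$ arc additions in $O(m^{3/2})$ total worst-case time, while maintaining a topological order and detecting cycles. -/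

import Mathlib

namespace SoftThreshold

/-! ## Selection of an (approximate) median by comparisons -/

/-- A comparison-based selection procedure for `k` candidates: a decision tree whose internal nodes
compare two of the candidates and whose leaves name the selected candidate. -/
inductive CmpTree (k : ℕ) : Type where
  | ret (i : Fin k) : CmpTree k
  | cmp (i j : Fin k) (yes no : CmpTree k) : CmpTree k

namespace CmpTree

/-- The candidate selected when candidate `i` has rank key `key i`. -/
def result {k : ℕ} (key : Fin k → ℕ) : CmpTree k → Fin k
  | ret i => i
  | cmp i j yes no => if key i < key j then result key yes else result key no

/-- The number of comparisons made when candidate `i` has rank key `key i`. -/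
def comparisons {k : ℕ} (key : Fin k → ℕ) : CmpTree k → ℕ
  | ret _ => 0
  | cmp i j yes no =>
      1 + (if key i < key j then comparisons key yes else comparisons key no)

/-- For every ordering of the `k` candidates, `t` selects a candidate `s` such that at least `ε * k`
candidates are `≤ s` and at least `ε * k` candidates are `≥ s` (for `ε = 1 / 2`: a median), and it
makes at most `a * k` comparisons. -/
def SelectsApproxMedian {k : ℕ} (ε : ℝ) (a : ℕ) (t : CmpTree k) : Prop :=
  ∀ key : Fin k → ℕ, Function.Injective key →
    ε * k ≤ (Finset.univ.filter fun i => key i ≤ key (t.result key)).card ∧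
    ε * k ≤ (Finset.univ.filter fun i => key (t.result key) ≤ key i).card ∧
    t.comparisons key ≤ a * k

end CmpTree

section Algorithm

variable {V : Type*} [DecidableEq V]

/-! ## Graphs and orders -/

/-- The relation "there is an arc from `x` to `y`" of the graph with list of arcs `arcs`. -/
def Arc (arcs : List (V × V)) (x y : V) : Prop := (x, y) ∈ arcs

/-- The graph has no cycle. -/
def Acyclic (arcs : List (V × V)) : Prop := ∀ x, ¬ Relation.TransGen (Arc arcs) x x

/-- The outgoing list of `x`: the heads of the arcs out of `x`, most recently added arc first. -/
def outList (arcs : List (V × V)) (x : V) : List V :=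
  (arcs.filter fun a => a.1 = x).map Prod.snd

/-- The incoming list of `y`: the tails of the arcs into `y`, most recently added arc first. -/
def inList (arcs : List (V × V)) (y : V) : List V :=
  (arcs.filter fun a => a.2 = y).map Prod.fst

/-- `x` comes strictly before `y` in the ordered list `ord` (an order query). -/
def Before (ord : List V) (x y : V) : Prop := ord.idxOf x < ord.idxOf y

instance (ord : List V) (x y : V) : Decidable (Before ord x y) :=
  inferInstanceAs (Decidable (ord.idxOf x < ord.idxOf y))

/-- `ord` lists every element of `V` exactly once. -/
def IsTotalOrder (ord : List V) : Prop := ord.Nodup ∧ ∀ x : V, x ∈ ord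

/-- `ord` is a topological order of the graph. -/
def IsTopologicalOrder (arcs : List (V × V)) (ord : List V) : Prop :=
  IsTotalOrder ord ∧ ∀ x y, Arc arcs x y → Before ord x y

/-- Delete `x` from the ordered list and insert it again just before `t`. -/
def moveBefore (t : V) (ord : List V) (x : V) : List V :=
  (ord.erase x).insertIdx ((ord.erase x).idxOf t) x

/-- Delete `x` from the ordered list and insert it again just after `t`. -/
def moveAfter (t : V) (ord : List V) (x : V) : List V :=
  (ord.erase x).insertIdx ((ord.erase x).idxOf t + 1) x

/-! ## Static topological sorting by repeated deletion of sources -/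

/-- The main loop. `deg y` is the number of arcs from not yet deleted vertices of `S` to `y`, and `Q`
is the set of current sources. The loop deletes an arbitrary source `x`, decreases the counters of
its successors and adds the new sources to `Q`; this takes `1` step plus `1` per arc out of `x`.
`DeleteSources adj S deg Q l c` means that the loop can output `l` in `c` steps. -/
inductive DeleteSources (adj : V → List V) (S : Finset V) :
    (V → ℕ) → Finset V → List V → ℕ → Prop
  | finish (deg : V → ℕ) : DeleteSources adj S deg ∅ [] 1
  | delete {deg : V → ℕ} {Q : Finset V} {x : V} {l : List V} {c : ℕ} (hx : x ∈ Q)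
      (h : DeleteSources adj S (fun y => deg y - (adj x).count y)
        (Q.erase x ∪ S.filter fun y => y ∈ adj x ∧ deg y - (adj x).count y = 0) l c) :
      DeleteSources adj S deg Q (x :: l) (1 + (adj x).length + c)

/-- The number of arcs from vertices of `S` to `y`. -/
def inDegree (adj : V → List V) (S : Finset V) (y : V) : ℕ := ∑ x ∈ S, (adj x).count y

/-- Topologically sorting, in `c` steps and with result `l`, the subgraph induced by `S` of the graph
with adjacency lists `adj`: scan the vertices in `S` and their arcs to compute the in-degrees, scan
`S` for sources, and run the main loop. -/
def TopSort (adj : V → List V) (S : Finset V) (l : List V) (c : ℕ) : Prop :=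
  ∃ c' : ℕ, DeleteSources adj S (inDegree adj S) (S.filter fun y => inDegree adj S y = 0) l c' ∧
    c = ∑ x ∈ S, (1 + (adj x).length) + S.card + c'

/-! ## Soft-threshold search -/

/-- The data of a soft-threshold search: the forward vertices `F` and backward vertices `B`, the
untraversed parts `out x` and `inp y` of the outgoing list of `x ∈ F` and the incoming list of
`y ∈ B` (`[]` is the null pointer), the soft threshold `s`, and the active and passive forward and
backward vertices. -/
structure SearchState (V : Type*) where
  F : Finset V
  B : Finset V
  out : V → List V
  inp : V → List V
  s : V
  FA : Finset V
  FP : Finset V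
  BA : Finset V
  BP : Finset V

namespace SearchState

/-- The state in which the search triggered by the arc `(v, w)` starts. -/
def init (arcs : List (V × V)) (v w : V) : SearchState V where
  F := {w}
  B := {v}
  out := Function.update (fun _ => []) w (outList arcs w)
  inp := Function.update (fun _ => []) v (inList arcs v)
  s := v
  FA := if outList arcs w = [] then ∅ else {w}
  FP := ∅
  BA := if inList arcs v = [] then ∅ else {v}
  BP := ∅

/-- Traverse the first untraversed arc out of `u` forward and the first untraversed arc into `z`
backward; `os` and `ins` are the remaining untraversed parts of the two lists. -/
def advance (st : SearchState V) (u z : V) (os ins : List V) : SearchState V :=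
  { st with
    out := Function.update st.out u os
    inp := Function.update st.inp z ins
    FA := if os = [] then st.FA.erase u else st.FA
    BA := if ins = [] then st.BA.erase z else st.BA }

/-- Visit `x` in the forward direction, unless it is forward already. -/
def visitForward (arcs : List (V × V)) (x : V) (st : SearchState V) : SearchState V :=
  if x ∈ st.F then st else
    { st with
      F := insert x st.F
      out := Function.update st.out x (outList arcs x)
      FA := if outList arcs x = [] then st.FA else insert x st.FA }

/-- Visit `y` in the backward direction, unless it is backward already. -/
def visitBackward (arcs : List (V × V)) (y : V) (st : SearchState V) : SearchState V :=
  if y ∈ st.B then st else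
    { st with
      B := insert y st.B
      inp := Function.update st.inp y (inList arcs y)
      BA := if inList arcs y = [] then st.BA else insert y st.BA }

/-- Make `u` passive if it is greater than `s`, and make `z` passive if it is less than `s`. -/
def makePassive (ord : List V) (u z : V) (st : SearchState V) : SearchState V :=
  { st with
    FA := if Before ord st.s u then st.FA.erase u else st.FA
    FP := if Before ord st.s u then insert u st.FP else st.FP
    BA := if Before ord z st.s then st.BA.erase z else st.BA
    BP := if Before ord z st.s then insert z st.BP else st.BP }

end SearchState

/-- The first part of a pass through the loop, up to the updating of the threshold. It continues
with a new state or returns an arc. An arc is returned as soon as some vertex is reached from both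
directions; this includes the case `y = x`, in which the two traversals of one pass reach the same
unvisited vertex. -/
inductive SearchStep (arcs : List (V × V)) (ord : List V) (st : SearchState V) :
    SearchState V ⊕ (V × V) → Prop
  | returnForward {u z x y : V} {os ins : List V} (hu : u ∈ st.FA) (hz : z ∈ st.BA)
      (huz : Before ord u z) (hout : st.out u = x :: os) (hin : st.inp z = y :: ins)
      (hx : x ∈ st.B) :
      SearchStep arcs ord st (.inr (u, x))
  | returnBackward {u z x y : V} {os ins : List V} (hu : u ∈ st.FA) (hz : z ∈ st.BA)
      (huz : Before ord u z) (hout : st.out u = x :: os) (hin : st.inp z = y :: ins)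
      (hx : x ∉ st.B) (hy : y ∈ st.F ∨ y = x) :
      SearchStep arcs ord st (.inr (y, z))
  | traverse {u z x y : V} {os ins : List V} (hu : u ∈ st.FA) (hz : z ∈ st.BA)
      (huz : Before ord u z) (hout : st.out u = x :: os) (hin : st.inp z = y :: ins)
      (hx : x ∉ st.B) (hy : ¬ (y ∈ st.F ∨ y = x)) :
      SearchStep arcs ord st
        (.inl (((st.advance u z os ins).visitForward arcs x).visitBackward arcs y))
  | passive {u z : V} (hu : u ∈ st.FA) (hz : z ∈ st.BA) (huz : ¬ Before ord u z) :
      SearchStep arcs ord st (.inl (st.makePassive ord u z))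

/-- `Select ε a ord P s c`: from the set `P` of candidates, some comparison-based procedure that
always finds an `ε`-approximate median of `|P|` candidates with at most `a * |P|` comparisons selects
`s`; reading the candidates takes `|P|` steps and every comparison made takes one step, in all `c`
steps. -/
def Select (ε : ℝ) (a : ℕ) (ord : List V) (P : Finset V) (s : V) (c : ℕ) : Prop :=
  ∃ (t : CmpTree P.card) (e : Fin P.card → V),
    t.SelectsApproxMedian ε a ∧ Function.Injective e ∧ Finset.univ.image e = P ∧
    s = e (t.result fun i => ord.idxOf (e i)) ∧
    c = P.card + t.comparisons fun i => ord.idxOf (e i)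

/-- The updating that follows when there are no active forward vertices: all passive backward
vertices and `s` die (one step per passive vertex), and, if there are passive forward vertices, a new
`s` is selected from them and those `≤ s` become active (one step per passive vertex to split). -/
inductive UpdateForward (ε : ℝ) (a : ℕ) (ord : List V) (st : SearchState V) :
    ℕ → SearchState V → Prop
  | skip (h : st.FA ≠ ∅) : UpdateForward ε a ord st 1 st
  | kill (h : st.FA = ∅) (hP : st.FP = ∅) :
      UpdateForward ε a ord st (1 + st.BP.card) { st with BP := ∅, BA := st.BA.erase st.s }
  | choose (h : st.FA = ∅) (hP : st.FP ≠ ∅) {s : V} {c : ℕ} (hs : Select ε a ord st.FP s c) :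
      UpdateForward ε a ord st (1 + st.BP.card + c + st.FP.card)
        { st with
          BP := ∅
          BA := st.BA.erase st.s
          s := s
          FA := st.FP.filter fun x => ¬ Before ord s x
          FP := st.FP.filter fun x => Before ord s x }

/-- The symmetric updating that follows when there are no active backward vertices. -/
inductive UpdateBackward (ε : ℝ) (a : ℕ) (ord : List V) (st : SearchState V) :
    ℕ → SearchState V → Prop
  | skip (h : st.BA ≠ ∅) : UpdateBackward ε a ord st 1 st
  | kill (h : st.BA = ∅) (hP : st.BP = ∅) :
      UpdateBackward ε a ord st (1 + st.FP.card) { st with FP := ∅, FA := st.FA.erase st.s }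
  | choose (h : st.BA = ∅) (hP : st.BP ≠ ∅) {s : V} {c : ℕ} (hs : Select ε a ord st.BP s c) :
      UpdateBackward ε a ord st (1 + st.FP.card + c + st.BP.card)
        { st with
          FP := ∅
          FA := st.FA.erase st.s
          s := s
          BA := st.BP.filter fun x => ¬ Before ord x s
          BP := st.BP.filter fun x => Before ord x s }

/-! ## Restoring the topological order after a search that returns null -/

/-- `t` is the minimum of `{v} ∪ {x ∈ F | out x ≠ null}`. -/
def IsPivot (ord : List V) (v : V) (st : SearchState V) (t : V) : Prop :=
  (t = v ∨ (t ∈ st.F ∧ st.out t ≠ [])) ∧ ¬ Before ord v t ∧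
    ∀ x ∈ st.F, st.out x ≠ [] → ¬ Before ord x t

/-- `F_<`, the forward vertices less than `t`. -/
def forwardBelow (ord : List V) (st : SearchState V) (t : V) : Finset V :=
  st.F.filter fun x => Before ord x t

/-- `B_>`, the backward vertices greater than `t`. -/
def backwardAbove (ord : List V) (st : SearchState V) (t : V) : Finset V :=
  st.B.filter fun y => Before ord t y

/-- Reordering with new order `ord'` in the given number of steps. Passes over `F` find `t` and `F_<`,
a pass over `B` finds `B_>`, and a pass over each of `F` and `B` clears the marks for the next search.
The vertices in `F_<` are sorted along their outgoing arcs and those in `B_>` along their incoming arcs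
(so that the list `bs` is in reverse topological order), and the vertices are moved one by one, with
one deletion and one insertion each. -/
inductive Reorder (arcs : List (V × V)) (ord : List V) (v : V) (st : SearchState V) :
    ℕ → List V → Prop
  | after {fs : List V} {c : ℕ} (ht : IsPivot ord v st v)
      (hF : TopSort (outList arcs) (forwardBelow ord st v) fs c) :
      Reorder arcs ord v st (1 + 3 * st.F.card + 2 * st.B.card + c + 2 * fs.length)
        (fs.reverse.foldl (moveAfter v) ord)
  | before {t : V} {fs bs : List V} {c d : ℕ} (ht : IsPivot ord v st t) (htv : t ≠ v)
      (hF : TopSort (outList arcs) (forwardBelow ord st t) fs c)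
      (hB : TopSort (inList arcs) (backwardAbove ord st t) bs d) :
      Reorder arcs ord v st
        (1 + 3 * st.F.card + 2 * st.B.card + c + d + 2 * bs.length + 2 * fs.length)
        (fs.foldl (moveBefore t) (bs.reverse.foldl (moveBefore t) ord))

/-! ## The incremental algorithm -/

/-- The configurations of the algorithm: waiting for the next arc addition; inside the search
triggered by the last added arc `(v, w)`; stopped after reporting the arc `a` when the addition of
`(v, w)` has created a cycle. In each case `arcs` lists the arcs added so far, last arc first, and
`ord` is the maintained order. -/
inductive Config (V : Type*) where
  | idle (arcs : List (V × V)) (ord : List V) : Config V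
  | search (arcs : List (V × V)) (ord : List V) (v w : V) (st : SearchState V) : Config V
  | cycle (arcs : List (V × V)) (v w : V) (a : V × V) : Config V

/-- The arcs added so far. -/
def Config.arcs : Config V → List (V × V)
  | .idle arcs _ => arcs
  | .search arcs _ _ _ _ => arcs
  | .cycle arcs _ _ _ => arcs

/-- `Step ε a cfg c cfg'`: the algorithm can go from `cfg` to `cfg'` in `c` time steps. One time step
is a block of boundedly many elementary operations without loops (following or setting pointers and
marks, linked-list insertions and deletions, order queries, insertions and deletions in the dynamic
ordered list `ord`). -/
inductive Step (ε : ℝ) (a : ℕ) : Config V → ℕ → Config V → Prop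
  | addForward {arcs : List (V × V)} {ord : List V} {v w : V} (hvw : v ≠ w)
      (hnew : (v, w) ∉ arcs) (h : Before ord v w) :
      Step ε a (.idle arcs ord) 1 (.idle ((v, w) :: arcs) ord)
  | addBackward {arcs : List (V × V)} {ord : List V} {v w : V} (hvw : v ≠ w)
      (hnew : (v, w) ∉ arcs) (h : Before ord w v) :
      Step ε a (.idle arcs ord) 1
        (.search ((v, w) :: arcs) ord v w (SearchState.init ((v, w) :: arcs) v w))
  | loop {arcs : List (V × V)} {ord : List V} {v w : V} {st st₁ st₂ st₃ : SearchState V} {c d : ℕ}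
      (h : SearchStep arcs ord st (.inl st₁)) (hF : UpdateForward ε a ord st₁ c st₂)
      (hB : UpdateBackward ε a ord st₂ d st₃) :
      Step ε a (.search arcs ord v w st) (1 + c + d) (.search arcs ord v w st₃)
  | reportCycle {arcs : List (V × V)} {ord : List V} {v w : V} {st : SearchState V} {b : V × V}
      (h : SearchStep arcs ord st (.inr b)) :
      Step ε a (.search arcs ord v w st) 1 (.cycle arcs v w b)
  | finish {arcs : List (V × V)} {ord ord' : List V} {v w : V} {st : SearchState V} {c : ℕ}
      (h : st.FA = ∅ ∨ st.BA = ∅) (hR : Reorder arcs ord v st c ord') :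
      Step ε a (.search arcs ord v w st) (1 + c) (.idle arcs ord')

/-- Every step takes positive time, so a bound on the time also bounds the number of steps. -/
theorem Step.pos {ε : ℝ} {a : ℕ} {cfg cfg' : Config V} {c : ℕ} (h : Step ε a cfg c cfg') :
    0 < c := by
  cases h <;> omega

/-- `Run ε a cfg T cfg'`: some (possibly unfinished) execution leads from `cfg` to `cfg'` and takes
total time `T`. -/
inductive Run (ε : ℝ) (a : ℕ) (cfg : Config V) : ℕ → Config V → Prop
  | refl : Run ε a cfg 0 cfg
  | tail {cfg₁ cfg₂ : Config V} {T c : ℕ} (h : Run ε a cfg T cfg₁) (hs : Step ε a cfg₁ c cfg₂) :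
      Run ε a cfg (T + c) cfg₂

/-- The configuration `cfg` is as it must be: whenever the algorithm is waiting, the graph is acyclic
and `ord` is a topological order of it; when it has reported a cycle, the reported arc is an old arc
that lies on a cycle formed by the new arc `(v, w)` and old arcs. -/
def Config.Correct : Config V → Prop
  | .idle arcs ord => Acyclic arcs ∧ IsTopologicalOrder arcs ord
  | .search _ _ _ _ _ => True
  | .cycle arcs v w b => ∃ old, arcs = (v, w) :: old ∧ Arc old b.1 b.2 ∧
      Relation.ReflTransGen (Arc old) w b.1 ∧ Relation.ReflTransGen (Arc old) b.2 v

/-- The algorithm cannot get stuck in `cfg`: if it is waiting, every new arc can be added, and a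
search in progress can be continued. -/
def Config.CanProceed (ε : ℝ) (a : ℕ) : Config V → Prop
  | .idle arcs ord => ∀ v w : V, v ≠ w → (v, w) ∉ arcs →
      ∃ c cfg', Step ε a (.idle arcs ord) c cfg' ∧ cfg'.arcs = (v, w) :: arcs
  | .search arcs ord v w st => ∃ c cfg', Step ε a (.search arcs ord v w st) c cfg'
  | .cycle _ _ _ _ => True

end Algorithm

end SoftThreshold

namespace SoftThreshold

/-! Time is bounded by counting traversals; one traversal pass follows one arc forward and one
backward.

Suppose the search for `(v, w)` makes τ such passes, with arcs (uᵢ, xᵢ) and (yᵢ, zᵢ), where uᵢ < zᵢ.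
For all i, j, either uᵢ < zⱼ or uⱼ < zᵢ, so at least τ²/2 ordered pairs (i, j) satisfy uᵢ < zⱼ. For
these, the new arc creates a path from zⱼ through v and w to uᵢ, and no such path existed before,
because zⱼ comes later in the old topological order. Thus at least τ²/2 pairs of arcs become related
(`SearchInv.sq_le_relatedPairs`). At most m² pairs are ever related, so the sum of τ² over completed
searches is at most 2m², and by Cauchy-Schwarz (`sq_add_le`) the sum of τ is at most √2 · m^(3/2).
The one search that may be unfinished has τ ≤ m.

It remains to see that a search costs O(τ + 1). At most 2(τ + 1) vertices are visited, and each dies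
at most once. Passes that only make vertices passive, and the selections of thresholds, are paid for
by deaths: when the side of the threshold is exhausted, the selected fraction of the candidates has
died; when the other side is exhausted, the candidates still passive and `s` itself die. This is the
invariant `SearchState.Paid`, carried across threshold changes by `pays_of_exhausted` and
`pays_of_opposite`. Reordering is linear in τ, since only vertices whose arcs have all been
traversed are sorted.

Correctness rests on the field `live` of `SearchInv`: a forward x and a backward y with x < y and
untraversed arcs are never dead. When one side is exhausted no such pair is left, and the reordering
around the pivot t is then valid. Progress needs selection trees for medians, supplied by median of
medians with 68k comparisons. -/

/-! ## Linear-time selection by comparisons -/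

/-- `Decides Post K c`: some decision tree with at most `c` comparisons on each branch yields, for
every ordering `key` of the candidates that satisfies `K`, a value `x` with `Post key x`. -/
inductive Decides {k : ℕ} {α : Type*} (Post : (Fin k → ℕ) → α → Prop) :
    ((Fin k → ℕ) → Prop) → ℕ → Prop
  | ret {K : (Fin k → ℕ) → Prop} {c : ℕ} (x : α) (h : ∀ key, K key → Post key x) :
      Decides Post K c
  | cmp {K : (Fin k → ℕ) → Prop} {c : ℕ} (i j : Fin k)
      (yes : Decides Post (fun key => K key ∧ key i < key j) c)
      (no : Decides Post (fun key => K key ∧ ¬ key i < key j) c) :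
      Decides Post K (c + 1)

namespace Decides

variable {k : ℕ} {α β : Type*}

theorem mono {Post Post' : (Fin k → ℕ) → α → Prop} {K K' : (Fin k → ℕ) → Prop} {c c' : ℕ}
    (h : Decides Post K c) (hc : c ≤ c') (hK : ∀ key, K' key → K key)
    (hPost : ∀ key x, K' key → Post key x → Post' key x) : Decides Post' K' c' := by
  induction h generalizing K' c' with
  | ret x h => exact .ret x fun key hkey => hPost key x hkey (h key (hK key hkey))
  | cmp i j _ _ ihy ihn =>
    obtain ⟨c', rfl⟩ : ∃ c'', c' = c'' + 1 := ⟨c' - 1, by omega⟩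
    exact .cmp i j
      (ihy (by omega) (fun key h => ⟨hK key h.1, h.2⟩) fun key x h => hPost key x h.1)
      (ihn (by omega) (fun key h => ⟨hK key h.1, h.2⟩) fun key x h => hPost key x h.1)

/-- Grafts a second tree onto every leaf of the first. The continuation is required only for values
that some admissible ordering produces, so facts about one such ordering may be used in building it.
-/
theorem bind [Nonempty β] {Post : (Fin k → ℕ) → α → Prop} {Post' : (Fin k → ℕ) → β → Prop}
    {K : (Fin k → ℕ) → Prop} {c d : ℕ} (h : Decides Post K c)
    (h' : ∀ x, (∃ key, K key ∧ Post key x) →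
      Decides Post' (fun key => K key ∧ Post key x) d) : Decides Post' K (c + d) := by
  induction h with
  | @ret K c x h =>
    by_cases hK : ∃ key, K key
    · obtain ⟨key, hkey⟩ := hK
      exact (h' x ⟨key, hkey, h key hkey⟩).mono (by omega) (fun key hk => ⟨hk, h key hk⟩)
        fun _ _ _ h => h
    -- No ordering reaches this leaf, so the value returned is irrelevant.
    · exact .ret (Classical.arbitrary β) fun key hk => (hK ⟨key, hk⟩).elim
  | @cmp K c i j _ _ ihy ihn =>
    rw [show c + 1 + d = c + d + 1 by omega]
    refine .cmp i j (ihy fun x hx => ?_) (ihn fun x hx => ?_)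
    · exact (h' x (hx.imp fun key hk => ⟨hk.1.1, hk.2⟩)).mono le_rfl
        (fun key hk => ⟨hk.1.1, hk.2⟩) fun _ _ _ h => h
    · exact (h' x (hx.imp fun key hk => ⟨hk.1.1, hk.2⟩)).mono le_rfl
        (fun key hk => ⟨hk.1.1, hk.2⟩) fun _ _ _ h => h

theorem exists_cmpTree {Post : (Fin k → ℕ) → Fin k → Prop} {K : (Fin k → ℕ) → Prop} {c : ℕ}
    (h : Decides Post K c) :
    ∃ t : CmpTree k, ∀ key, K key → Post key (t.result key) ∧ t.comparisons key ≤ c := by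
  induction h with
  | ret x h => exact ⟨.ret x, fun key hk => ⟨h key hk, Nat.zero_le _⟩⟩
  | cmp i j _ _ ihy ihn =>
    obtain ⟨ty, hy⟩ := ihy
    obtain ⟨tn, hn⟩ := ihn
    refine ⟨.cmp i j ty tn, fun key hk => ?_⟩
    by_cases h : key i < key j
    · have := hy key ⟨hk, h⟩
      simp only [CmpTree.result, CmpTree.comparisons, if_pos h]
      exact ⟨this.1, by omega⟩
    · have := hn key ⟨hk, h⟩
      simp only [CmpTree.result, CmpTree.comparisons, if_neg h]
      exact ⟨this.1, by omega⟩

theorem partition (K : (Fin k → ℕ) → Prop) (S : Finset (Fin k)) (p : Fin k) :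
    Decides (fun key L => L = S.filter fun y => key y < key p) K S.card := by
  induction S using Finset.induction_on with
  | empty => exact .ret ∅ fun key _ => by simp
  | insert x S hx ih =>
    rw [Finset.card_insert_of_notMem hx]
    refine ih.bind (d := 1) fun L _ => .cmp x p (.ret (insert x L) ?_) (.ret L ?_)
    · rintro key ⟨⟨_, rfl⟩, h⟩
      rw [Finset.filter_insert, if_pos h]
    · rintro key ⟨⟨_, rfl⟩, h⟩
      rw [Finset.filter_insert, if_neg h]

end Decides

/-- `x` is the element of `S` with exactly `r` smaller elements in `S`. -/
def HasRank {k : ℕ} (S : Finset (Fin k)) (r : ℕ) (key : Fin k → ℕ) (x : Fin k) : Prop :=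
  x ∈ S ∧ (S.filter fun y => key y < key x).card = r

/-! ### Selecting a given rank: median of medians -/

section Selection

variable {k : ℕ}

theorem card_lt_add_card_gt {S : Finset (Fin k)} {p : Fin k} {key : Fin k → ℕ}
    (hkey : Function.Injective key) (hp : p ∈ S) :
    (S.filter fun y => key y < key p).card + (S.filter fun y => key p < key y).card + 1
      = S.card := by
  have h1 : S.filter (fun y => ¬ key y < key p) = insert p (S.filter fun y => key p < key y) := by
    ext y
    have : key y = key p ↔ y = p := hkey.eq_iff
    simp only [Finset.mem_filter, Finset.mem_insert]
    grind
  have h2 := Finset.card_filter_add_card_filter_not (s := S) (fun y => key y < key p)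
  rw [h1, Finset.card_insert_of_notMem (by simp)] at h2
  omega

/-- One round of quickselect: comparing all of `S` with `p` leaves a side of size at most `b` in
which the wanted element has a known rank. -/
theorem decides_hasRank_of_pivot {S : Finset (Fin k)} {p : Fin k} {r b c : ℕ}
    {K : (Fin k → ℕ) → Prop} (hp : p ∈ S) (hr : r < S.card)
    (hK : ∀ key, K key → Function.Injective key)
    (hb : ∀ key, K key → (S.filter fun y => key y < key p).card ≤ b ∧
      (S.filter fun y => key p < key y).card ≤ b)
    (rec : ∀ S' : Finset (Fin k), ∀ r', S'.card ≤ b → r' < S'.card →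
      Decides (HasRank S' r') Function.Injective c) :
    Decides (HasRank S r) K (S.card + c) := by
  have : Nonempty (Fin k) := ⟨p⟩
  refine (Decides.partition K S p).bind ?_
  -- On this branch `L` is a fixed set, so its size can be bounded with any single ordering `key₀`
  -- that leads here.
  rintro L ⟨key₀, hk₀, hL₀⟩
  have hb₀ := hb key₀ hk₀
  have hsum := card_lt_add_card_gt (hK key₀ hk₀) hp
  rcases lt_trichotomy r L.card with h | h | h
  · refine (rec L r (by rw [hL₀]; exact hb₀.1) h).mono le_rfl (fun key hk => hK key hk.1) ?_
    rintro key x ⟨hk, rfl⟩ ⟨hx, hrank⟩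
    simp only [Finset.mem_filter] at hx
    refine ⟨hx.1, ?_⟩
    rw [← hrank, Finset.filter_filter]
    congr 1
    ext y
    simp only [Finset.mem_filter]
    grind
  · refine .ret p ?_
    rintro key ⟨hk, rfl⟩
    exact ⟨hp, h.symm⟩
  · have hU : (S \ insert p L) = S.filter fun y => key₀ p < key₀ y := by
      ext y
      have : key₀ y = key₀ p ↔ y = p := (hK key₀ hk₀).eq_iff
      simp only [hL₀, Finset.mem_filter, Finset.mem_insert, Finset.mem_sdiff]
      grind
    have hLc := congrArg Finset.card hL₀
    have hUc := congrArg Finset.card hU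
    refine (rec (S \ insert p L) (r - L.card - 1) (by omega) (by omega)).mono le_rfl
      (fun key hk => hK key hk.1) ?_
    rintro key x ⟨hk, hL⟩ ⟨hx, hrank⟩
    have hpL : p ∉ L := by simp [hL]
    have hinj : ∀ y, key y = key p ↔ y = p := fun y => (hK key hk).eq_iff
    have hxp : key p < key x := by
      have := hinj x
      simp only [hL, Finset.mem_filter, Finset.mem_insert, Finset.mem_sdiff] at hx
      grind
    refine ⟨(Finset.mem_sdiff.1 hx).1, ?_⟩
    have : S.filter (fun y => key y < key x) =
        insert p L ∪ (S \ insert p L).filter fun y => key y < key x := by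
      ext y
      have := hinj y
      simp only [hL, Finset.mem_filter, Finset.mem_insert, Finset.mem_sdiff, Finset.mem_union]
      grind
    rw [this, Finset.card_union_of_disjoint, hrank, Finset.card_insert_of_notMem hpL]
    · omega
    · exact Finset.disjoint_left.2 fun y hy hy' =>
        (Finset.mem_sdiff.1 (Finset.mem_filter.1 hy').1).2 hy

/-- Quickselect with an arbitrary pivot, by n + (n - 1)² ≤ n². It serves the groups of five and the
base case of the linear bound. -/
theorem decides_hasRank_sq (S : Finset (Fin k)) (r : ℕ) (hr : r < S.card) :
    Decides (HasRank S r) Function.Injective (S.card * S.card) := by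
  induction hn : S.card using Nat.strong_induction_on generalizing S r with
  | _ n ih =>
    obtain ⟨p, hp⟩ := Finset.card_pos.1 (by omega : 0 < S.card)
    have key : Decides (HasRank S r) Function.Injective (S.card + (n - 1) * (n - 1)) := by
      refine decides_hasRank_of_pivot (b := n - 1) hp hr (fun _ h => h) ?_ ?_
      · intro key hkey
        have := card_lt_add_card_gt hkey hp
        omega
      · intro S' r' hS' hr'
        exact (ih S'.card (by omega) S' r' hr' rfl).mono (Nat.mul_le_mul hS' hS')
          (fun _ h => h) fun _ _ _ h => h
    refine key.mono ?_ (fun _ h => h) fun _ _ _ h => h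
    obtain ⟨n, rfl⟩ : ∃ m, n = m + 1 := ⟨n - 1, by omega⟩
    simp only [Nat.add_sub_cancel, hn]
    nlinarith

/-- The medians of `j` disjoint groups of five elements: for each bound `p`, every median on one side
of `p` brings at least three elements of its group on that side. -/
theorem decides_group_medians (j : ℕ) (S : Finset (Fin k)) (hS : 5 * j ≤ S.card) :
    Decides (fun key M => M ⊆ S ∧ M.card = j ∧ ∀ p,
      3 * (M.filter fun q => key q ≤ key p).card ≤ (S.filter fun q => key q ≤ key p).card ∧
      3 * (M.filter fun q => key p ≤ key q).card ≤ (S.filter fun q => key p ≤ key q).card)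
      Function.Injective (25 * j) := by
  induction j generalizing S with
  | zero => exact .ret ∅ fun key _ => by simp
  | succ j ih =>
    obtain ⟨G, hGS, hG⟩ := Finset.exists_subset_card_eq (show 5 ≤ S.card by omega)
    have hcard := Finset.card_sdiff_of_subset hGS
    have h1 := (ih (S \ G) (by omega)).bind (d := 25)
      (Post' := fun key M => M ⊆ S ∧ M.card = j + 1 ∧ ∀ p,
        3 * (M.filter fun q => key q ≤ key p).card ≤ (S.filter fun q => key q ≤ key p).card ∧
        3 * (M.filter fun q => key p ≤ key q).card ≤ (S.filter fun q => key p ≤ key q).card) ?_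
    · exact h1.mono (by omega) (fun _ h => h) fun _ _ _ h => h
    rintro M ⟨key₀, -, hM₀, hMc, -⟩
    -- Rank 2 among five elements is the median: with itself, three elements of `G` lie on each
    -- side.
    have h2 := decides_hasRank_sq G 2 (by omega)
    rw [hG] at h2
    have h3 := h2.bind (d := 0)
      (Post' := fun key M' => M' ⊆ S ∧ (M ⊆ S \ G → M.card = j → (∀ p,
        3 * (M.filter fun q => key q ≤ key p).card ≤
          ((S \ G).filter fun q => key q ≤ key p).card ∧
        3 * (M.filter fun q => key p ≤ key q).card ≤
          ((S \ G).filter fun q => key p ≤ key q).card) → M'.card = j + 1 ∧ ∀ p,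
        3 * (M'.filter fun q => key q ≤ key p).card ≤ (S.filter fun q => key q ≤ key p).card ∧
        3 * (M'.filter fun q => key p ≤ key q).card ≤ (S.filter fun q => key p ≤ key q).card)) ?_
    · refine h3.mono le_rfl (fun _ h => h.1) ?_
      rintro key M' ⟨_, ha, hb, hc⟩ ⟨h4, h5⟩
      exact ⟨h4, h5 ha hb hc⟩
    rintro m ⟨key₁, hk₁, hm₁, -⟩
    refine .ret (insert m M) ?_
    rintro key ⟨hkey, hm, hrank⟩
    refine ⟨Finset.insert_subset (hGS hm) (hM₀.trans Finset.sdiff_subset), fun _ _ hp => ?_⟩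
    have hmM : m ∉ M := fun h => (Finset.mem_sdiff.1 (hM₀ h)).2 hm
    refine ⟨by rw [Finset.card_insert_of_notMem hmM, hMc], fun p => ?_⟩
    have hsum := card_lt_add_card_gt hkey hm
    have split : ∀ P : Fin k → Prop, [DecidablePred P] →
        (S.filter P).card = (G.filter P).card + ((S \ G).filter P).card := by
      intro P _
      rw [← Finset.card_union_of_disjoint, ← Finset.filter_union, Finset.union_sdiff_of_subset hGS]
      exact Finset.disjoint_filter_filter Finset.disjoint_sdiff
    have hge : 3 ≤ (G.filter fun y => key m ≤ key y).card := by
      have : insert m (G.filter fun y => key m < key y) ⊆ G.filter fun y => key m ≤ key y := by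
        intro y
        simp only [Finset.mem_filter, Finset.mem_insert]
        grind
      have := Finset.card_le_card this
      rw [Finset.card_insert_of_notMem (by simp)] at this
      omega
    have hle : 3 ≤ (G.filter fun y => key y ≤ key m).card := by
      have : insert m (G.filter fun y => key y < key m) ⊆ G.filter fun y => key y ≤ key m := by
        intro y
        simp only [Finset.mem_filter, Finset.mem_insert]
        grind
      have := Finset.card_le_card this
      rw [Finset.card_insert_of_notMem (by simp)] at this
      omega
    rw [Finset.filter_insert, Finset.filter_insert, split, split]
    have hp := hp p
    constructor
    · split_ifs with h
      · have : (G.filter fun y => key y ≤ key m).card ≤ (G.filter fun y => key y ≤ key p).card :=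
          Finset.card_le_card (Finset.monotone_filter_right _ fun y _ hy => hy.trans h)
        rw [Finset.card_insert_of_notMem (by simp [hmM])]
        omega
      · omega
    · split_ifs with h
      · have : (G.filter fun y => key m ≤ key y).card ≤ (G.filter fun y => key p ≤ key y).card :=
          Finset.card_le_card (Finset.monotone_filter_right _ fun y _ hy => h.trans hy)
        rw [Finset.card_insert_of_notMem (by simp [hmM])]
        omega
      · omega

/-- Median of medians: the pivot is the middle one of the medians of j = n/5 groups. At least j -
j/2 of these medians lie weakly on either side of it, and each brings three elements. -/
theorem decides_hasRank_linear (S : Finset (Fin k)) (r : ℕ) (hr : r < S.card) :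
    Decides (HasRank S r) Function.Injective (68 * S.card) := by
  induction hn : S.card using Nat.strong_induction_on generalizing S r with
  | _ n ih =>
    obtain ⟨p₀, -⟩ := Finset.card_pos.1 (by omega : 0 < S.card)
    have : Nonempty (Fin k) := ⟨p₀⟩
    by_cases h5 : n < 5
    · refine (decides_hasRank_sq S r hr).mono ?_ (fun _ h => h) fun _ _ _ h => h
      rw [hn]
      nlinarith
    obtain ⟨j, hj⟩ : ∃ j, j = n / 5 := ⟨_, rfl⟩
    set b := n - 3 * (j - j / 2) with hb
    have h1 := (decides_group_medians j S (by omega)).bind (d := 68 * j + (n + 68 * b))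
      (Post' := HasRank S r) ?_
    -- Source of 68: with b ≤ n - 3j/2, the bound 25j + cj + n + cb ≤ cn follows from n + 25j ≤
    -- cj/2. Since n ≤ 5j + 4 ≤ 9j for n ≥ 5, the value c = 68 suffices.
    · exact h1.mono (by omega) (fun _ h => h) fun _ _ _ h => h
    rintro M ⟨key₀, -, hMS, hMc, -⟩
    have h2 := (ih M.card (by omega) M (j / 2) (by omega) rfl)
    rw [hMc] at h2
    refine (h2.mono (K' := fun key => Function.Injective key ∧ _) le_rfl (fun _ h => h.1)
      fun _ _ _ h => h).bind ?_
    rintro p ⟨key₁, -, hpM, -⟩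
    rw [← hn]
    refine decides_hasRank_of_pivot (b := b) (hMS hpM) hr (fun _ h => h.1.1) ?_ ?_
    · rintro key ⟨⟨hkey, -, -, hM⟩, -, hrank⟩
      have hsumM := card_lt_add_card_gt hkey hpM
      have hsumS := card_lt_add_card_gt hkey (hMS hpM)
      have hle : ∀ A : Finset (Fin k), p ∈ A → (A.filter fun q => key q ≤ key p).card =
          (A.filter fun q => key q < key p).card + 1 := by
        intro A hA
        rw [← Finset.card_insert_of_notMem (a := p) (by simp)]
        congr 1
        ext y
        have : key y = key p ↔ y = p := hkey.eq_iff
        simp only [Finset.mem_filter, Finset.mem_insert]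
        grind
      have hge : ∀ A : Finset (Fin k), p ∈ A → (A.filter fun q => key p ≤ key q).card =
          (A.filter fun q => key p < key q).card + 1 := by
        intro A hA
        rw [← Finset.card_insert_of_notMem (a := p) (by simp)]
        congr 1
        ext y
        have : key y = key p ↔ y = p := hkey.eq_iff
        simp only [Finset.mem_filter, Finset.mem_insert]
        grind
      have := hM p
      rw [hle M hpM, hge M hpM, hle S (hMS hpM), hge S (hMS hpM)] at this
      omega
    · intro S' r' hS' hr'
      exact (ih S'.card (by omega) S' r' hr' rfl).mono (by omega) (fun _ h => h)
        fun _ _ _ h => h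

theorem exists_selectsApproxMedian (k : ℕ) :
    ∃ t : CmpTree (k + 1), t.SelectsApproxMedian (1 / 2) 68 := by
  obtain ⟨t, ht⟩ :=
    (decides_hasRank_linear (Finset.univ : Finset (Fin (k + 1))) (k / 2)
      (by simp only [Finset.card_univ, Fintype.card_fin]; omega)).exists_cmpTree
  refine ⟨t, fun key hkey => ?_⟩
  obtain ⟨⟨hx, hrank⟩, hc⟩ := ht key hkey
  set x := t.result key
  have hsum := card_lt_add_card_gt hkey hx
  simp only [Finset.card_univ, Fintype.card_fin] at hsum hc
  have h1 := Finset.card_filter_add_card_filter_not (s := Finset.univ) (fun y => key x < key y)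
  have h2 := Finset.card_filter_add_card_filter_not (s := Finset.univ) (fun y => key y < key x)
  simp only [not_lt, Finset.card_univ, Fintype.card_fin] at h1 h2
  refine ⟨?_, ?_, hc⟩
  · have : k + 1 ≤ 2 * (Finset.univ.filter fun y => key y ≤ key x).card := by omega
    have : ((k + 1 : ℕ) : ℝ) ≤ 2 * ((Finset.univ.filter fun y => key y ≤ key x).card : ℝ) := by
      exact_mod_cast this
    linarith
  · have : k + 1 ≤ 2 * (Finset.univ.filter fun y => key x ≤ key y).card := by omega
    have : ((k + 1 : ℕ) : ℝ) ≤ 2 * ((Finset.univ.filter fun y => key x ≤ key y).card : ℝ) := by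
      exact_mod_cast this
    linarith

theorem CmpTree.SelectsApproxMedian.mono {ε ε' : ℝ} {a a' : ℕ} {t : CmpTree k}
    (h : t.SelectsApproxMedian ε a) (hε : ε' ≤ ε) (ha : a ≤ a') : t.SelectsApproxMedian ε' a' := by
  intro key hkey
  obtain ⟨h1, h2, h3⟩ := h key hkey
  have : ε' * k ≤ ε * k := by gcongr
  exact ⟨this.trans h1, this.trans h2, h3.trans (by gcongr)⟩

end Selection

/-- In a list sorted along `adj` and along the strict order `r`, arcs go forward. -/
theorem rel_of_pairwise {V : Type*} {adj : V → List V} {r : V → V → Prop} {l : List V}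
    (h : l.Pairwise r) (hadj : l.Pairwise fun x y => x ∉ adj y) {x y : V} (hx : x ∈ l)
    (hy : y ∈ l) (hxy : y ∈ adj x) (hne : x ≠ y) : r x y := by
  have hp : l.Pairwise fun x y => (y ∈ adj x → r x y) ∧ (x ∈ adj y → r y x) :=
    (h.and hadj).imp fun h => ⟨fun _ => h.1, fun h' => (h.2 h').elim⟩
  have : Std.Symm fun x y => (y ∈ adj x → r x y) ∧ (x ∈ adj y → r y x) :=
    ⟨fun _ _ h => ⟨h.2, h.1⟩⟩
  exact (hp.forall hx hy hne).1 hxy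

section Orders

variable {V : Type*} [DecidableEq V]

/-! ## Moving vertices in the ordered list -/

theorem Before.trans {ord : List V} {x y z : V} (h : Before ord x y) (h' : Before ord y z) :
    Before ord x z := Nat.lt_trans h h'

theorem Before.asymm {ord : List V} {x y : V} (h : Before ord x y) : ¬ Before ord y x :=
  Nat.lt_asymm h

theorem Before.irrefl {ord : List V} {x : V} : ¬ Before ord x x := Nat.lt_irrefl _

theorem Before.ne {ord : List V} {x y : V} (h : Before ord x y) : x ≠ y := by
  rintro rfl
  exact Before.irrefl h

theorem IsTotalOrder.idxOf_injective {ord : List V} (h : IsTotalOrder ord) :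
    Function.Injective fun x => ord.idxOf x := fun x _ hxy => (List.idxOf_inj (h.2 x)).1 hxy

theorem IsTotalOrder.before_or_before {ord : List V} (h : IsTotalOrder ord) {x y : V}
    (hxy : x ≠ y) : Before ord x y ∨ Before ord y x :=
  Nat.lt_or_gt_of_ne fun h' => hxy (h.idxOf_injective h')

theorem idxOf_erase {l : List V} (hl : l.Nodup) {x a : V} (hx : x ∈ l) (hax : a ≠ x) :
    (l.erase x).idxOf a = if l.idxOf x < l.idxOf a then l.idxOf a - 1 else l.idxOf a := by
  induction l with
  | nil => simp at hx
  | cons b l ih =>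
    by_cases hbx : b = x
    · subst hbx
      simp [List.idxOf_cons_ne _ hax.symm]
    · have hx' : x ∈ l := (List.mem_cons.1 hx).resolve_left fun h => hbx h.symm
      rw [List.erase_cons_tail (by simpa using hbx), List.idxOf_cons_ne _ hbx]
      by_cases hba : b = a
      · subst hba
        simp
      · rw [List.idxOf_cons_ne _ hba, List.idxOf_cons_ne _ hba, ih hl.of_cons hx']
        split_ifs <;> omega

theorem idxOf_insertIdx_self {l : List V} {x : V} (hx : x ∉ l) {i : ℕ} (hi : i ≤ l.length) :
    (l.insertIdx i x).idxOf x = i := by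
  induction l generalizing i with
  | nil => obtain rfl : i = 0 := by simpa using hi
           simp
  | cons b l ih =>
    cases i with
    | zero => simp
    | succ i =>
      simp only [List.mem_cons, not_or] at hx
      rw [List.insertIdx_succ_cons, List.idxOf_cons_ne _ (Ne.symm hx.1),
        ih hx.2 (by simpa using hi)]

theorem idxOf_insertIdx_of_ne {l : List V} {x a : V} (hax : a ≠ x) {i : ℕ} (hi : i ≤ l.length) :
    (l.insertIdx i x).idxOf a = if l.idxOf a < i then l.idxOf a else l.idxOf a + 1 := by
  induction l generalizing i with
  | nil => obtain rfl : i = 0 := by simpa using hi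
           simp [List.idxOf_cons_ne _ hax.symm]
  | cons b l ih =>
    cases i with
    | zero => simp [List.idxOf_cons_ne _ hax.symm]
    | succ i =>
      rw [List.insertIdx_succ_cons]
      by_cases hba : b = a
      · subst hba
        simp
      · rw [List.idxOf_cons_ne _ hba, List.idxOf_cons_ne _ hba, ih (by simpa using hi)]
        split_ifs <;> omega

theorem IsTotalOrder.erase_insertIdx {ord : List V} (h : IsTotalOrder ord) (x : V) {i : ℕ}
    (hi : i ≤ (ord.erase x).length) : IsTotalOrder ((ord.erase x).insertIdx i x) := by
  have hp : ((ord.erase x).insertIdx i x).Perm ord :=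
    (List.perm_insertIdx _ _ hi).trans (List.perm_cons_erase (h.2 x)).symm
  exact ⟨hp.nodup_iff.2 h.1, fun y => hp.mem_iff.2 (h.2 y)⟩

theorem IsTotalOrder.moveBefore {ord : List V} (h : IsTotalOrder ord) (t x : V) :
    IsTotalOrder (moveBefore t ord x) := h.erase_insertIdx x List.idxOf_le_length

theorem IsTotalOrder.idxOf_erase_lt {ord : List V} (h : IsTotalOrder ord) {t x : V}
    (hxt : x ≠ t) : (ord.erase x).idxOf t < (ord.erase x).length :=
  List.idxOf_lt_length_iff.2 ((List.mem_erase_of_ne hxt.symm).2 (h.2 t))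

theorem IsTotalOrder.moveAfter {ord : List V} (h : IsTotalOrder ord) {t x : V} (hxt : x ≠ t) :
    IsTotalOrder (moveAfter t ord x) := h.erase_insertIdx x (h.idxOf_erase_lt hxt)

theorem before_erase_insertIdx_iff {ord : List V} (h : IsTotalOrder ord) {x a b : V} {i : ℕ}
    (hi : i ≤ (ord.erase x).length) (ha : a ≠ x) (hb : b ≠ x) :
    Before ((ord.erase x).insertIdx i x) a b ↔ Before ord a b := by
  have hx := h.2 x
  have hax : ord.idxOf a ≠ ord.idxOf x := fun h' => ha (h.idxOf_injective h')
  have hbx : ord.idxOf b ≠ ord.idxOf x := fun h' => hb (h.idxOf_injective h')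
  rw [Before, Before, idxOf_insertIdx_of_ne ha hi, idxOf_insertIdx_of_ne hb hi,
    idxOf_erase h.1 hx ha, idxOf_erase h.1 hx hb]
  split_ifs <;> omega

theorem before_moveBefore_iff {ord : List V} (h : IsTotalOrder ord) {t x a : V} (hxt : x ≠ t)
    (hax : a ≠ x) : Before (moveBefore t ord x) a x ↔ Before ord a t := by
  have hx := h.2 x
  have hxe : x ∉ ord.erase x := fun h' => by simpa using (h.1.mem_erase_iff.1 h').1
  have hi := (h.idxOf_erase_lt hxt).le
  have hax' : ord.idxOf a ≠ ord.idxOf x := fun h' => hax (h.idxOf_injective h')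
  have hxt' : ord.idxOf x ≠ ord.idxOf t := fun h' => hxt (h.idxOf_injective h')
  rw [Before, Before, SoftThreshold.moveBefore, idxOf_insertIdx_self hxe hi,
    idxOf_insertIdx_of_ne hax hi,
    idxOf_erase h.1 hx hax, idxOf_erase h.1 hx hxt.symm]
  split_ifs <;> omega

theorem before_moveAfter_iff {ord : List V} (h : IsTotalOrder ord) {t x a : V} (hxt : x ≠ t)
    (hax : a ≠ x) : Before (moveAfter t ord x) x a ↔ Before ord t a := by
  have hx := h.2 x
  have hxe : x ∉ ord.erase x := fun h' => by simpa using (h.1.mem_erase_iff.1 h').1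
  have hi := Nat.succ_le_of_lt (h.idxOf_erase_lt hxt)
  have hax' : ord.idxOf a ≠ ord.idxOf x := fun h' => hax (h.idxOf_injective h')
  have hxt' : ord.idxOf x ≠ ord.idxOf t := fun h' => hxt (h.idxOf_injective h')
  rw [Before, Before, SoftThreshold.moveAfter, idxOf_insertIdx_self hxe hi,
    idxOf_insertIdx_of_ne hax hi,
    idxOf_erase h.1 hx hax, idxOf_erase h.1 hx hxt.symm]
  split_ifs <;> omega

/-- Each vertex lands immediately before `t`, hence after the vertices moved earlier. So `l` becomes
a block in its own order, and vertices outside it see the block where they saw `t`. -/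
theorem foldl_moveBefore {t : V} (l : List V) {ord : List V} (h : IsTotalOrder ord)
    (hl : l.Nodup) (ht : t ∉ l) :
    IsTotalOrder (l.foldl (moveBefore t) ord) ∧
    (∀ a b, a ∉ l → b ∉ l → (Before (l.foldl (moveBefore t) ord) a b ↔ Before ord a b)) ∧
    (∀ a x, a ∉ l → x ∈ l → (Before (l.foldl (moveBefore t) ord) a x ↔ Before ord a t)) ∧
    l.Pairwise (Before (l.foldl (moveBefore t) ord)) := by
  induction l generalizing ord with
  | nil => simpa using h
  | cons x l ih =>
    simp only [List.nodup_cons, List.mem_cons, not_or] at hl ht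
    have hxt : x ≠ t := Ne.symm ht.1
    have hm (a b : V) (ha : a ≠ x) (hb : b ≠ x) :
        Before (moveBefore t ord x) a b ↔ Before ord a b :=
      before_erase_insertIdx_iff h (h.idxOf_erase_lt hxt).le ha hb
    obtain ⟨h1, h2, h3, h4⟩ := ih (h.moveBefore t x) hl.2 ht.2
    simp only [List.foldl_cons, List.mem_cons, not_or, List.pairwise_cons]
    refine ⟨h1, fun a b ha hb => ?_, fun a y ha hy => ?_, fun y hy => ?_, h4⟩
    · rw [h2 a b ha.2 hb.2, hm a b ha.1 hb.1]
    · rcases hy with rfl | hy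
      · rw [h2 a y ha.2 hl.1, before_moveBefore_iff h hxt ha.1]
      · rw [h3 a y ha.2 hy, hm a t ha.1 hxt.symm]
    · rw [h3 x y hl.1 hy]
      refine ((h.moveBefore t x).before_or_before hxt).resolve_right fun h' => ?_
      exact Before.irrefl ((before_moveBefore_iff h hxt hxt.symm).1 h')

/-- Insertion immediately after `t` puts each vertex ahead of those moved earlier, so the block
comes out in reverse. -/
theorem foldl_moveAfter {t : V} (l : List V) {ord : List V} (h : IsTotalOrder ord)
    (hl : l.Nodup) (ht : t ∉ l) :
    IsTotalOrder (l.foldl (moveAfter t) ord) ∧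
    (∀ a b, a ∉ l → b ∉ l → (Before (l.foldl (moveAfter t) ord) a b ↔ Before ord a b)) ∧
    (∀ a x, a ∉ l → x ∈ l → (Before (l.foldl (moveAfter t) ord) x a ↔ Before ord t a)) ∧
    l.Pairwise (fun x y => Before (l.foldl (moveAfter t) ord) y x) := by
  induction l generalizing ord with
  | nil => simpa using h
  | cons x l ih =>
    simp only [List.nodup_cons, List.mem_cons, not_or] at hl ht
    have hxt : x ≠ t := Ne.symm ht.1
    have hm (a b : V) (ha : a ≠ x) (hb : b ≠ x) :
        Before (moveAfter t ord x) a b ↔ Before ord a b :=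
      before_erase_insertIdx_iff h (h.idxOf_erase_lt hxt) ha hb
    obtain ⟨h1, h2, h3, h4⟩ := ih (h.moveAfter hxt) hl.2 ht.2
    simp only [List.foldl_cons, List.mem_cons, not_or, List.pairwise_cons]
    refine ⟨h1, fun a b ha hb => ?_, fun a y ha hy => ?_, fun y hy => ?_, h4⟩
    · rw [h2 a b ha.2 hb.2, hm a b ha.1 hb.1]
    · rcases hy with rfl | hy
      · rw [h2 y a hl.1 ha.2, before_moveAfter_iff h hxt ha.1]
      · rw [h3 a y ha.2 hy, hm t a hxt.symm ha.1]
    · rw [h3 x y hl.1 hy]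
      refine ((h.moveAfter hxt).before_or_before hxt).resolve_left fun h' => ?_
      exact Before.irrefl ((before_moveAfter_iff h hxt hxt.symm).1 h')

/-! ## Static topological sorting -/

theorem inDegree_erase {adj : V → List V} {R : Finset V} {x : V} (hx : x ∈ R) (y : V) :
    inDegree adj (R.erase x) y = inDegree adj R y - (adj x).count y := by
  rw [inDegree, inDegree, ← Finset.add_sum_erase R _ hx]
  omega

theorem inDegree_eq_zero {adj : V → List V} {R : Finset V} {y : V} :
    inDegree adj R y = 0 ↔ ∀ x ∈ R, y ∉ adj x := by
  simp [inDegree, Finset.sum_eq_zero_iff, List.count_eq_zero]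

/-- New sources are looked for in all of `S`, not only among the undeleted vertices `R`. By `hdel`
no arc leads from `R` to a deleted vertex, so none reappears. -/
theorem sources_erase {adj : V → List V} {S R : Finset V} (hRS : R ⊆ S)
    (hdel : ∀ y ∈ S, y ∉ R → inDegree adj R y = 0) {x : V}
    (hx : x ∈ R.filter fun y => inDegree adj R y = 0) :
    (R.filter fun y => inDegree adj R y = 0).erase x ∪
        S.filter (fun y => y ∈ adj x ∧ inDegree adj R y - (adj x).count y = 0) =
      (R.erase x).filter fun y => inDegree adj (R.erase x) y = 0 := by
  obtain ⟨hxR, hx0⟩ := Finset.mem_filter.1 hx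
  ext y
  simp only [Finset.mem_union, Finset.mem_erase, Finset.mem_filter, inDegree_erase hxR]
  constructor
  · rintro (⟨hyx, hyR, hy0⟩ | ⟨hyS, hyx, hy0⟩)
    · exact ⟨⟨hyx, hyR⟩, by omega⟩
    · refine ⟨⟨?_, ?_⟩, hy0⟩
      · rintro rfl
        exact inDegree_eq_zero.1 hx0 y hxR hyx
      · by_contra hyR
        exact inDegree_eq_zero.1 (hdel y hyS hyR) x hxR hyx
  · rintro ⟨⟨hyx, hyR⟩, hy0⟩
    by_cases hya : y ∈ adj x
    · exact Or.inr ⟨hRS hyR, hya, hy0⟩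
    · rw [List.count_eq_zero.2 hya] at hy0
      exact Or.inl ⟨hyx, hyR, hy0⟩

theorem inDegree_erase_eq_zero {adj : V → List V} {S R : Finset V}
    (hdel : ∀ y ∈ S, y ∉ R → inDegree adj R y = 0) {x : V}
    (hx : x ∈ R.filter fun y => inDegree adj R y = 0) :
    ∀ y ∈ S, y ∉ R.erase x → inDegree adj (R.erase x) y = 0 := by
  obtain ⟨hxR, hx0⟩ := Finset.mem_filter.1 hx
  intro y hyS hy
  rw [inDegree_erase hxR]
  by_cases hyx : y = x
  · rw [hyx, hx0, Nat.zero_sub]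
  · rw [hdel y hyS fun h => hy (Finset.mem_erase.2 ⟨hyx, h⟩), Nat.zero_sub]

theorem exists_source {adj : V → List V} {R : Finset V} {pos : V → ℤ}
    (hpos : ∀ x ∈ R, ∀ y ∈ adj x, pos x < pos y) (hR : R.Nonempty) :
    (R.filter fun y => inDegree adj R y = 0).Nonempty := by
  obtain ⟨x, hx, hmin⟩ := R.exists_min_image pos hR
  exact ⟨x, Finset.mem_filter.2 ⟨hx, inDegree_eq_zero.2 fun y hy hxy =>
    (hmin y hy).not_gt (hpos y hy x hxy)⟩⟩

/-- With `R` the undeleted vertices, the counters are the in-degrees from `R` and the queue is the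
set of sources of `R`. The potential `pos` guarantees a source, so the loop cannot stop while `R` is
nonempty. It is integer-valued so that it can be negated for sorting along incoming arcs. -/
theorem DeleteSources.spec {adj : V → List V} {S : Finset V} {pos : V → ℤ}
    (hpos : ∀ x ∈ S, ∀ y ∈ adj x, pos x < pos y) {deg : V → ℕ} {Q : Finset V} {l : List V} {c : ℕ}
    (h : DeleteSources adj S deg Q l c) {R : Finset V} (hRS : R ⊆ S)
    (hdel : ∀ y ∈ S, y ∉ R → inDegree adj R y = 0) (hdeg : deg = inDegree adj R)
    (hQ : Q = R.filter fun y => inDegree adj R y = 0) :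
    l.Nodup ∧ (∀ x, x ∈ l ↔ x ∈ R) ∧ l.Pairwise (fun x y => x ∉ adj y) ∧
      c = 1 + ∑ x ∈ R, (1 + (adj x).length) := by
  induction h generalizing R with
  | finish deg =>
    rcases R.eq_empty_or_nonempty with rfl | hR
    · simp
    · exact absurd hQ.symm (exists_source (fun x hx => hpos x (hRS hx)) hR).ne_empty
  | @delete deg Q x l c hx h ih =>
    subst hdeg hQ
    obtain ⟨hxR, hx0⟩ := Finset.mem_filter.1 hx
    obtain ⟨h1, h2, h3, h4⟩ := ih ((Finset.erase_subset _ _).trans hRS)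
      (inDegree_erase_eq_zero hdel hx)
      (funext fun y => (inDegree_erase hxR y).symm) (sources_erase hRS hdel hx)
    refine ⟨List.nodup_cons.2 ⟨by simp [h2], h1⟩, fun y => ?_, List.pairwise_cons.2 ⟨?_, h3⟩, ?_⟩
    · rw [List.mem_cons, h2, Finset.mem_erase]
      by_cases hyx : y = x <;> simp [hyx, hxR]
    · intro y hy
      exact inDegree_eq_zero.1 hx0 y (Finset.mem_of_mem_erase ((h2 y).1 hy))
    · rw [h4, ← Finset.add_sum_erase R _ hxR]
      omega

theorem DeleteSources.exists {adj : V → List V} {S : Finset V} {pos : V → ℤ}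
    (hpos : ∀ x ∈ S, ∀ y ∈ adj x, pos x < pos y) {R : Finset V} (hRS : R ⊆ S)
    (hdel : ∀ y ∈ S, y ∉ R → inDegree adj R y = 0) :
    ∃ l c, DeleteSources adj S (inDegree adj R) (R.filter fun y => inDegree adj R y = 0) l c := by
  induction hn : R.card generalizing R with
  | zero =>
    obtain rfl := Finset.card_eq_zero.1 hn
    exact ⟨[], 1, by simpa using .finish _⟩
  | succ n ih =>
    obtain ⟨x, hx⟩ := exists_source (fun x hx => hpos x (hRS hx)) (Finset.card_pos.1 (by omega))
    have hxR := (Finset.mem_filter.1 hx).1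
    obtain ⟨l, c, h⟩ := ih ((Finset.erase_subset x _).trans hRS) (inDegree_erase_eq_zero hdel hx)
      (by rw [Finset.card_erase_of_mem hxR]; omega)
    refine ⟨x :: l, _, .delete (c := c) hx ?_⟩
    rw [sources_erase hRS hdel hx]
    exact (funext fun y => inDegree_erase hxR y : inDegree adj (R.erase x) = _) ▸ h

theorem TopSort.exists {adj : V → List V} {S : Finset V} {pos : V → ℤ}
    (hpos : ∀ x ∈ S, ∀ y ∈ adj x, pos x < pos y) : ∃ l c, TopSort adj S l c := by
  obtain ⟨l, c, h⟩ := DeleteSources.exists hpos subset_rfl fun y hy hy' => (hy' hy).elim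
  exact ⟨l, _, c, h, rfl⟩

theorem TopSort.spec {adj : V → List V} {S : Finset V} {pos : V → ℤ}
    (hpos : ∀ x ∈ S, ∀ y ∈ adj x, pos x < pos y) {l : List V} {c : ℕ} (h : TopSort adj S l c) :
    l.Nodup ∧ (∀ x, x ∈ l ↔ x ∈ S) ∧ l.Pairwise (fun x y => x ∉ adj y) ∧ l.length = S.card ∧
      c = 3 * S.card + 2 * ∑ x ∈ S, (adj x).length + 1 := by
  obtain ⟨c', h, rfl⟩ := h
  obtain ⟨h1, h2, h3, h4⟩ := h.spec hpos subset_rfl (fun y hy hy' => (hy' hy).elim) rfl rfl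
  refine ⟨h1, h2, h3, ?_, ?_⟩
  · rw [← List.toFinset_card_of_nodup h1]
    congr 1
    ext x
    simp [h2]
  · simp only [h4, Finset.sum_add_distrib, Finset.sum_const, smul_eq_mul, mul_one]
    omega

end Orders

section SearchInvariant

variable {V : Type*} [DecidableEq V]

/-! ## The invariant of a search -/

@[simp] theorem mem_outList {arcs : List (V × V)} {x y : V} : y ∈ outList arcs x ↔ (x, y) ∈ arcs := by
  simp [outList]

@[simp] theorem mem_inList {arcs : List (V × V)} {x y : V} : x ∈ inList arcs y ↔ (x, y) ∈ arcs := by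
  simp [inList]

theorem nodup_outList {arcs : List (V × V)} (h : arcs.Nodup) (x : V) : (outList arcs x).Nodup := by
  refine List.Nodup.map_on ?_ (h.filter _)
  simp only [List.mem_filter, decide_eq_true_eq]
  grind

theorem nodup_inList {arcs : List (V × V)} (h : arcs.Nodup) (x : V) : (inList arcs x).Nodup := by
  refine List.Nodup.map_on ?_ (h.filter _)
  simp only [List.mem_filter, decide_eq_true_eq]
  grind

/-- The situation in which a search starts: `(v, w)` is added to the acyclic graph `old`, and `w`
comes before `v` in the topological order `ord` of `old`. -/
structure SearchContext (old : List (V × V)) (ord : List V) (v w : V) : Prop where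
  nodup : old.Nodup
  notMem : (v, w) ∉ old
  topological : IsTopologicalOrder old ord
  before : Before ord w v

/-- The structural invariant of a search; `L` lists the pairs of arcs traversed so far. -/
structure SearchInv (old : List (V × V)) (ord : List V) (v w : V) (st : SearchState V)
    (L : List ((V × V) × (V × V))) : Prop where
  mem_F : w ∈ st.F
  mem_B : v ∈ st.B
  disjoint : ∀ x ∈ st.F, x ∉ st.B
  reach_F : ∀ x ∈ st.F, Relation.ReflTransGen (Arc old) w x
  reach_B : ∀ x ∈ st.B, Relation.ReflTransGen (Arc old) x v
  FA_spec : ∀ x ∈ st.FA, x ∈ st.F ∧ x ∉ st.FP ∧ st.out x ≠ []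
  BA_spec : ∀ x ∈ st.BA, x ∈ st.B ∧ x ∉ st.BP ∧ st.inp x ≠ []
  FP_spec : ∀ x ∈ st.FP, x ∈ st.F ∧ st.out x ≠ [] ∧ Before ord st.s x
  BP_spec : ∀ x ∈ st.BP, x ∈ st.B ∧ st.inp x ≠ [] ∧ Before ord x st.s
  out_nodup : ∀ x ∈ st.F, (st.out x).Nodup
  inp_nodup : ∀ x ∈ st.B, (st.inp x).Nodup
  out_sub : ∀ x ∈ st.F, ∀ y ∈ st.out x, (x, y) ∈ old
  inp_sub : ∀ y ∈ st.B, ∀ x ∈ st.inp y, (x, y) ∈ old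
  traversed_out : ∀ x ∈ st.F, ∀ y, (x, y) ∈ old → y ∈ st.out x ∨ (x, y) ∈ L.map Prod.fst
  traversed_inp : ∀ y ∈ st.B, ∀ x, (x, y) ∈ old → x ∈ st.inp y ∨ (x, y) ∈ L.map Prod.snd
  nodup_fst : (L.map Prod.fst).Nodup
  nodup_snd : (L.map Prod.snd).Nodup
  pairs_fst : ∀ p ∈ L.map Prod.fst, p ∈ old ∧ p.1 ∈ st.F ∧ p.2 ∈ st.F ∧ p.2 ∉ st.out p.1
  pairs_snd : ∀ p ∈ L.map Prod.snd, p ∈ old ∧ p.1 ∈ st.B ∧ p.2 ∈ st.B ∧ p.1 ∉ st.inp p.2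
  pairs_before : ∀ p ∈ L, Before ord p.1.1 p.2.2
  live : ∀ x ∈ st.F, ∀ y ∈ st.B, st.out x ≠ [] → st.inp y ≠ [] → Before ord x y →
    (x ∈ st.FA ∨ x ∈ st.FP) ∧ (y ∈ st.BA ∨ y ∈ st.BP)
  card_F : st.F.card ≤ L.length + 1
  card_B : st.B.card ≤ L.length + 1

variable {old : List (V × V)} {ord : List V} {v w : V} {st : SearchState V}
  {L : List ((V × V) × (V × V))}

theorem mem_outList_cons {x y : V} (hx : x ≠ v) :
    y ∈ outList ((v, w) :: old) x ↔ (x, y) ∈ old := by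
  simp [hx]

theorem mem_inList_cons {x y : V} (hy : y ≠ w) :
    x ∈ inList ((v, w) :: old) y ↔ (x, y) ∈ old := by
  simp [hy]

theorem SearchContext.nodup_cons (hc : SearchContext old ord v w) : ((v, w) :: old).Nodup :=
  List.nodup_cons.2 ⟨hc.notMem, hc.nodup⟩

theorem SearchContext.searchInv_init (hc : SearchContext old ord v w) :
    SearchInv old ord v w (SearchState.init ((v, w) :: old) v w) [] := by
  have hvw := hc.before.ne
  constructor <;> try simp only [SearchState.init]
  case FA_spec => grind
  case BA_spec => grind
  case live => grind
  case out_nodup => simpa using nodup_outList hc.nodup_cons w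
  case inp_nodup => simpa using nodup_inList hc.nodup_cons v
  case reach_F => grind
  case reach_B => grind
  case disjoint => grind
  case out_sub => grind [mem_outList]
  case inp_sub => grind [mem_inList]
  case traversed_out => grind [mem_outList]
  case traversed_inp => grind [mem_inList]
  all_goals simp

/-! ### The invariant under a pass that traverses two arcs -/

section Traverse

variable {arcs : List (V × V)} {u z x y : V} {os ins : List V}

/-- The state after the traversal of `(u, x)` and `(y, z)`. -/
def SearchState.afterTraversal (arcs : List (V × V)) (st : SearchState V) (u z x y : V)
    (os ins : List V) : SearchState V :=
  ((st.advance u z os ins).visitForward arcs x).visitBackward arcs y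

theorem afterTraversal_F : (st.afterTraversal arcs u z x y os ins).F = insert x st.F := by
  simp only [SearchState.afterTraversal, SearchState.visitBackward, SearchState.visitForward,
    SearchState.advance]
  grind

theorem afterTraversal_B : (st.afterTraversal arcs u z x y os ins).B = insert y st.B := by
  simp only [SearchState.afterTraversal, SearchState.visitBackward, SearchState.visitForward,
    SearchState.advance]
  grind

theorem afterTraversal_s : (st.afterTraversal arcs u z x y os ins).s = st.s := by
  simp only [SearchState.afterTraversal, SearchState.visitBackward, SearchState.visitForward,
    SearchState.advance]
  grind

theorem afterTraversal_FP : (st.afterTraversal arcs u z x y os ins).FP = st.FP := by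
  simp only [SearchState.afterTraversal, SearchState.visitBackward, SearchState.visitForward,
    SearchState.advance]
  grind

theorem afterTraversal_BP : (st.afterTraversal arcs u z x y os ins).BP = st.BP := by
  simp only [SearchState.afterTraversal, SearchState.visitBackward, SearchState.visitForward,
    SearchState.advance]
  grind

theorem mem_afterTraversal_FA {b : V} : b ∈ (st.afterTraversal arcs u z x y os ins).FA ↔
    (b ∈ st.FA ∧ (b = u → os ≠ [])) ∨ (b = x ∧ x ∉ st.F ∧ outList arcs x ≠ []) := by
  by_cases hx : x ∈ st.F <;> by_cases hy : y ∈ st.B <;>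
    simp only [SearchState.afterTraversal, SearchState.visitBackward, SearchState.visitForward,
      SearchState.advance, hx, hy, if_true, if_false] <;> grind

theorem mem_afterTraversal_BA {b : V} : b ∈ (st.afterTraversal arcs u z x y os ins).BA ↔
    (b ∈ st.BA ∧ (b = z → ins ≠ [])) ∨ (b = y ∧ y ∉ st.B ∧ inList arcs y ≠ []) := by
  by_cases hx : x ∈ st.F <;> by_cases hy : y ∈ st.B <;>
    simp only [SearchState.afterTraversal, SearchState.visitBackward, SearchState.visitForward,
      SearchState.advance, hx, hy, if_true, if_false] <;> grind

theorem afterTraversal_out {b : V} : (st.afterTraversal arcs u z x y os ins).out b =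
    if b = x ∧ x ∉ st.F then outList arcs x else if b = u then os else st.out b := by
  by_cases hx : x ∈ st.F <;> by_cases hy : y ∈ st.B <;>
    simp only [SearchState.afterTraversal, SearchState.visitBackward, SearchState.visitForward,
      SearchState.advance, hx, hy, if_true, if_false, Function.update_apply] <;> grind

theorem afterTraversal_inp {b : V} : (st.afterTraversal arcs u z x y os ins).inp b =
    if b = y ∧ y ∉ st.B then inList arcs y else if b = z then ins else st.inp b := by
  by_cases hx : x ∈ st.F <;> by_cases hy : y ∈ st.B <;>
    simp only [SearchState.afterTraversal, SearchState.visitBackward, SearchState.visitForward,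
      SearchState.advance, hx, hy, if_true, if_false, Function.update_apply] <;> grind

/-- As `x` is not backward and `y` not forward, `x ≠ v` and `y ≠ w`; the new arc is therefore absent
from the lists opened here, and the search sees only old arcs. -/
theorem SearchInv.traverse (hc : SearchContext old ord v w) (h : SearchInv old ord v w st L)
    (hu : u ∈ st.FA) (hz : z ∈ st.BA) (huz : Before ord u z) (hout : st.out u = x :: os)
    (hin : st.inp z = y :: ins) (hx : x ∉ st.B) (hy : y ∉ st.F) (hyx : y ≠ x) :
    SearchInv old ord v w (st.afterTraversal ((v, w) :: old) u z x y os ins)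
      (((u, x), (y, z)) :: L) := by
  have huF := (h.FA_spec u hu).1
  have hzB := (h.BA_spec z hz).1
  have hux : (u, x) ∈ old := h.out_sub u huF x (by simp [hout])
  have hyz : (y, z) ∈ old := h.inp_sub z hzB y (by simp [hin])
  have hbux := hc.topological.2 u x hux
  have hbyz := hc.topological.2 y z hyz
  have hxv : x ≠ v := fun e => hx (e ▸ h.mem_B)
  have hyw : y ≠ w := fun e => hy (e ▸ h.mem_F)
  have hmo (b) : b ∈ outList ((v, w) :: old) x ↔ (x, b) ∈ old := mem_outList_cons hxv
  have hmi (b) : b ∈ inList ((v, w) :: old) y ↔ (b, y) ∈ old := mem_inList_cons hyw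
  have hno := nodup_outList hc.nodup_cons x
  have hni := nodup_inList hc.nodup_cons y
  have hnu := hout ▸ h.out_nodup u huF
  have hnz := hin ▸ h.inp_nodup z hzB
  generalize hol : outList ((v, w) :: old) x = ol at *
  generalize hil : inList ((v, w) :: old) y = il at *
  have hFA (b : V) := mem_afterTraversal_FA (st := st) (arcs := (v, w) :: old) (u := u) (z := z)
    (x := x) (y := y) (os := os) (ins := ins) (b := b)
  have hBA (b : V) := mem_afterTraversal_BA (st := st) (arcs := (v, w) :: old) (u := u) (z := z)
    (x := x) (y := y) (os := os) (ins := ins) (b := b)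
  have hO (b : V) := afterTraversal_out (st := st) (arcs := (v, w) :: old) (u := u) (z := z)
    (x := x) (y := y) (os := os) (ins := ins) (b := b)
  have hI (b : V) := afterTraversal_inp (st := st) (arcs := (v, w) :: old) (u := u) (z := z)
    (x := x) (y := y) (os := os) (ins := ins) (b := b)
  rw [hol] at hFA
  rw [hil] at hBA
  simp only [hol] at hO
  simp only [hil] at hI
  constructor <;>
    simp only [afterTraversal_F, afterTraversal_B, afterTraversal_s, afterTraversal_FP,
      afterTraversal_BP, List.map_cons, List.length_cons, List.forall_mem_cons]
  case mem_F => exact Finset.mem_insert_of_mem h.mem_F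
  case mem_B => exact Finset.mem_insert_of_mem h.mem_B
  case disjoint => grind [h.disjoint]
  case reach_F =>
    intro b hb
    rcases Finset.mem_insert.1 hb with rfl | hb
    · exact (h.reach_F u huF).tail hux
    · exact h.reach_F b hb
  case reach_B =>
    intro b hb
    rcases Finset.mem_insert.1 hb with rfl | hb
    · exact (h.reach_B z hzB).head hyz
    · exact h.reach_B b hb
  case FA_spec => grind [h.FA_spec, h.FP_spec]
  case BA_spec => grind [h.BA_spec, h.BP_spec]
  case FP_spec => grind [h.FA_spec, h.FP_spec]
  case BP_spec => grind [h.BA_spec, h.BP_spec]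
  case out_nodup => grind [h.out_nodup]
  case inp_nodup => grind [h.inp_nodup]
  case out_sub => grind [h.out_sub]
  case inp_sub => grind [h.inp_sub]
  case traversed_out => grind [h.traversed_out]
  case traversed_inp => grind [h.traversed_inp]
  case nodup_fst =>
    refine List.nodup_cons.2 ⟨fun hm => ?_, h.nodup_fst⟩
    exact (h.pairs_fst _ hm).2.2.2 (by simp [hout])
  case nodup_snd =>
    refine List.nodup_cons.2 ⟨fun hm => ?_, h.nodup_snd⟩
    exact (h.pairs_snd _ hm).2.2.2 (by simp [hin])
  case pairs_fst =>
    refine ⟨by grind [Before.irrefl], fun p hp => ?_⟩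
    have := h.pairs_fst p hp
    grind
  case pairs_snd =>
    refine ⟨by grind [Before.irrefl], fun p hp => ?_⟩
    have := h.pairs_snd p hp
    grind
  case pairs_before => exact ⟨huz, h.pairs_before⟩
  case live =>
    -- Before the pass `u` and `z` still have untraversed arcs. Since u < x and y < z, a vertex
    -- beyond `x` is also beyond `u`, and one below `y` is below `z`; so the old `live` applies to
    -- the partners of the new vertices.
    have hl1 : ∀ b ∈ st.B, st.inp b ≠ [] → Before ord u b → b ∈ st.BA ∨ b ∈ st.BP :=
      fun b hb hb' hub => (h.live u huF b hb (by simp [hout]) hb' hub).2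
    have hl2 : ∀ b ∈ st.F, st.out b ≠ [] → Before ord b z → b ∈ st.FA ∨ b ∈ st.FP :=
      fun b hb hb' hub => (h.live b hb z hzB hb' (by simp [hin]) hub).1
    intro b hb d hd hbo hdi hbd
    have h3 : b = x → Before ord u d := fun e => hbux.trans (e ▸ hbd)
    have h4 : d = y → Before ord b z := fun e => Before.trans (e ▸ hbd) hbyz
    have h5 := h.live b
    grind
  case card_F => exact (Finset.card_insert_le _ _).trans (by have := h.card_F; omega)
  case card_B => exact (Finset.card_insert_le _ _).trans (by have := h.card_B; omega)

end Traverse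

theorem SearchInv.ne_of_mem_FA (h : SearchInv old ord v w st L) {u z : V} (hu : u ∈ st.FA)
    (hz : z ∈ st.BA) : u ≠ z := fun e =>
  h.disjoint u (h.FA_spec u hu).1 (e ▸ (h.BA_spec z hz).1)

/-- Making vertices passive and changing the threshold affect only five fields of the invariant; the
others depend on visited vertices, pointers and traversed arcs. -/
theorem SearchInv.congr {st' : SearchState V} (h : SearchInv old ord v w st L)
    (hF : st'.F = st.F) (hB : st'.B = st.B) (hout : st'.out = st.out) (hinp : st'.inp = st.inp)
    (FA_spec : ∀ x ∈ st'.FA, x ∈ st'.F ∧ x ∉ st'.FP ∧ st'.out x ≠ [])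
    (BA_spec : ∀ x ∈ st'.BA, x ∈ st'.B ∧ x ∉ st'.BP ∧ st'.inp x ≠ [])
    (FP_spec : ∀ x ∈ st'.FP, x ∈ st'.F ∧ st'.out x ≠ [] ∧ Before ord st'.s x)
    (BP_spec : ∀ x ∈ st'.BP, x ∈ st'.B ∧ st'.inp x ≠ [] ∧ Before ord x st'.s)
    (live : ∀ x ∈ st'.F, ∀ y ∈ st'.B, st'.out x ≠ [] → st'.inp y ≠ [] → Before ord x y →
      (x ∈ st'.FA ∨ x ∈ st'.FP) ∧ (y ∈ st'.BA ∨ y ∈ st'.BP)) : SearchInv old ord v w st' L := by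
  obtain ⟨F, B, out, inp, s, FA, FP, BA, BP⟩ := st'
  dsimp only at hF hB hout hinp
  subst hF hB hout hinp
  exact { h with
    FA_spec := FA_spec, BA_spec := BA_spec, FP_spec := FP_spec, BP_spec := BP_spec, live := live }

theorem SearchInv.makePassive (h : SearchInv old ord v w st L) {u z : V} (hu : u ∈ st.FA)
    (hz : z ∈ st.BA) : SearchInv old ord v w (st.makePassive ord u z) L := by
  have := h.FA_spec
  have := h.BA_spec
  have := h.FP_spec
  have := h.BP_spec
  have := h.live
  refine h.congr rfl rfl rfl rfl ?_ ?_ ?_ ?_ ?_ <;> simp only [SearchState.makePassive]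
  case refine_5 =>
    intro x hx y hy hxo hyi hxy
    have := h.live x hx y hy hxo hyi hxy
    grind
  all_goals grind

/-- Killing is safe. Without active forward vertices, the surviving ones are passive and lie above
the old `s`, whereas the backward vertices killed are `s` or lie below it, so they form no pair for
`live`. If nothing is passive either, no forward vertex takes part in such a pair. -/
theorem SearchInv.updateForward {ε : ℝ} {a c : ℕ} {st' : SearchState V}
    (h : SearchInv old ord v w st L) (hU : UpdateForward ε a ord st c st') :
    SearchInv old ord v w st' L := by
  have h1 := h.FA_spec
  have h2 := h.BA_spec
  have h3 := h.FP_spec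
  have h4 := h.BP_spec
  cases hU with
  | skip => exact h
  | kill hFA hFP =>
    refine h.congr rfl rfl rfl rfl ?_ ?_ ?_ ?_ ?_ <;> dsimp only
    case refine_5 =>
      intro x hx y hy hxo hyi hxy
      have := h.live x hx y hy hxo hyi hxy
      grind
    all_goals grind
  | choose hFA hFP hs =>
    refine h.congr rfl rfl rfl rfl ?_ ?_ ?_ ?_ ?_ <;> dsimp only
    case refine_5 =>
      intro x hx y hy hxo hyi hxy
      have := h.live x hx y hy hxo hyi hxy
      have h5 : Before ord y st.s → Before ord st.s x → False := fun h h' =>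
        (h.trans h').asymm hxy
      have h6 : Before ord st.s x → y ≠ st.s := fun h' e => h'.asymm (e ▸ hxy)
      grind
    all_goals grind

theorem SearchInv.updateBackward {ε : ℝ} {a c : ℕ} {st' : SearchState V}
    (h : SearchInv old ord v w st L) (hU : UpdateBackward ε a ord st c st') :
    SearchInv old ord v w st' L := by
  have h1 := h.FA_spec
  have h2 := h.BA_spec
  have h3 := h.FP_spec
  have h4 := h.BP_spec
  cases hU with
  | skip => exact h
  | kill hFA hFP =>
    refine h.congr rfl rfl rfl rfl ?_ ?_ ?_ ?_ ?_ <;> dsimp only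
    case refine_5 =>
      intro x hx y hy hxo hyi hxy
      have := h.live x hx y hy hxo hyi hxy
      grind
    all_goals grind
  | choose hFA hFP hs =>
    refine h.congr rfl rfl rfl rfl ?_ ?_ ?_ ?_ ?_ <;> dsimp only
    case refine_5 =>
      intro x hx y hy hxo hyi hxy
      have := h.live x hx y hy hxo hyi hxy
      have h5 : Before ord y st.s → Before ord st.s x → False := fun h h' =>
        (h.trans h').asymm hxy
      have h6 : Before ord y st.s → x ≠ st.s := fun h' e => h'.asymm (e ▸ hxy)
      grind
    all_goals grind

end SearchInvariant

section SearchCost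

variable {V : Type*} [DecidableEq V]

/-! ## The time of a search -/

theorem Select.mem {ε : ℝ} {a c : ℕ} {ord : List V} {P : Finset V} {s : V}
    (h : Select ε a ord P s c) : s ∈ P := by
  obtain ⟨t, e, -, -, himg, rfl, -⟩ := h
  exact (Finset.ext_iff.1 himg _).1 (Finset.mem_image_of_mem e (Finset.mem_univ _))

/-- An integer `K ≥ 1 / ε` replaces the real fraction: each weak side of `s` holds at least a `1 /
K` share of the candidates. The extra 1 in `a + 1` is for reading the candidates. -/
theorem Select.spec {ε : ℝ} {a K c : ℕ} {ord : List V} {P : Finset V} {s : V}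
    (hord : IsTotalOrder ord) (hK : 1 ≤ ε * K) (h : Select ε a ord P s c) :
    s ∈ P ∧ P.card ≤ K * (P.filter fun x => ¬ Before ord s x).card ∧
      P.card ≤ K * (P.filter fun x => ¬ Before ord x s).card ∧ c ≤ (a + 1) * P.card := by
  have hmem := h.mem
  obtain ⟨t, e, ht, he, himg, rfl, rfl⟩ := h
  obtain ⟨h1, h2, h3⟩ := ht (fun i => ord.idxOf (e i)) (hord.idxOf_injective.comp he)
  set s := t.result fun i => ord.idxOf (e i)
  have hcard : ∀ p : V → Prop, [DecidablePred p] →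
      (P.filter p).card = (Finset.univ.filter fun i => p (e i)).card := by
    intro p _
    conv_lhs => rw [← himg, Finset.filter_image]
    exact Finset.card_image_of_injective _ he
  have hmul : ∀ m : ℕ, ε * P.card ≤ m → P.card ≤ K * m := by
    intro m hm
    have : (P.card : ℝ) ≤ K * m := calc
      (P.card : ℝ) = 1 * P.card := (one_mul _).symm
      _ ≤ ε * K * P.card := by gcongr
      _ = K * (ε * P.card) := by ring
      _ ≤ K * m := by gcongr
    exact_mod_cast this
  refine ⟨hmem, hmul _ ?_, hmul _ ?_, by linarith⟩
  · rw [hcard]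
    simpa only [Before, not_lt] using h1
  · rw [hcard]
    simpa only [Before, not_lt] using h2

theorem card_filter_le_card_filter_add_one {P : Finset V} {p q : V → Prop} [DecidablePred p]
    [DecidablePred q] {s : V} (h : ∀ x, ¬ p x → x ≠ s → q x) :
    (P.filter fun x => ¬ p x).card ≤ (P.filter q).card + 1 := by
  refine (Finset.card_le_card (t := insert s (P.filter q)) fun x hx => ?_).trans
    (Finset.card_insert_le _ _)
  have := h x
  simp only [Finset.mem_filter, Finset.mem_insert] at hx ⊢
  grind

/-- The time that a vertex can pay for by dying. -/
def deathCredit (K a : ℕ) : ℕ := (a + 5) * K + 4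

/-- The amortized bound for a search in progress with `τ` traversals and cost `cost`. The candidates
from which `s` was selected split into those on the active side of `s`, which form `QF` or `QB`
according to the direction of `s`, and `ρ` others, which are still passive. A vertex pays when it is
visited and has died, but the deaths in `QF` and `QB` pay only when `s` changes. -/
def SearchState.Paid (K a : ℕ) (ord : List V) (st : SearchState V) (τ cost : ℕ) : Prop :=
  ∃ QF QB : Finset V, ∃ ρ : ℕ, QF ⊆ st.F ∧ QB ⊆ st.B ∧
    (∀ x ∈ QF, ¬ Before ord st.s x) ∧ (∀ x ∈ QB, ¬ Before ord x st.s) ∧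
    ((QB = ∅ ∧ st.s ∈ QF ∧ ρ ≤ st.FP.card ∧ QF.card + ρ ≤ K * QF.card ∧
        QF.card + ρ ≤ K * (ρ + 1)) ∨
      (QF = ∅ ∧ st.s ∈ QB ∧ ρ ≤ st.BP.card ∧ QB.card + ρ ≤ K * QB.card ∧
        QB.card + ρ ≤ K * (ρ + 1))) ∧
    cost + deathCredit K a *
        ((st.FA ∪ QF).card + st.FP.card + (st.BA ∪ QB).card + st.BP.card) + 3 * ρ ≤
      3 * τ + deathCredit K a * (st.F.card + st.B.card) + (a + 5) * (QF.card + QB.card + ρ) +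
        3 * (st.FP.card + st.BP.card)

/-- The threshold's own side is exhausted: the `q` active candidates have died, and `q + ρ ≤ K * q`
lets them pay the debt `a + 5` per candidate of the last selection. That debt is `a + 1` for
selecting, 1 for splitting and 3 for the pass in which the candidate became passive. The 4 in
`deathCredit` lets each of the `b` opposite passive vertices, which die now, pay 3 for its passive
pass and 1 for being cleared. -/
theorem pays_of_exhausted {K a f b q ρ A A' cost X : ℕ}
    (h : cost + deathCredit K a * (q + f + A + b) + 3 * ρ ≤ X + (a + 5) * (q + ρ) + 3 * (f + b))
    (hq : q + ρ ≤ K * q) (hA : A' ≤ A) :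
    cost + (b + (a + 2) * f) + deathCredit K a * (f + A') ≤ X + (a + 5) * f := by
  have h1 : (a + 5) * (q + ρ) ≤ (a + 5) * (K * q) := Nat.mul_le_mul_left _ hq
  have h2 : deathCredit K a * A' ≤ deathCredit K a * A := Nat.mul_le_mul_left _ hA
  have h3 : deathCredit K a * q = (a + 5) * (K * q) + 4 * q := by rw [deathCredit]; ring
  have h4 : 4 * b ≤ deathCredit K a * b := Nat.mul_le_mul_right _ (by rw [deathCredit]; omega)
  linarith

/-- The side opposite to the threshold is exhausted: the passive vertices on the threshold's side
and `s` itself die. They are `b + 1 ≥ ρ + 1` deaths, and `q + ρ ≤ K * (ρ + 1)`; the death of `s` is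
indispensable when `ρ = 0`. -/
theorem pays_of_opposite {K a f b q ρ A A' cost X : ℕ}
    (h : cost + deathCredit K a * (f + A + b) + 3 * ρ ≤ X + (a + 5) * (q + ρ) + 3 * (f + b))
    (hq : q + ρ ≤ K * (ρ + 1)) (hρ : ρ ≤ b) (hA : A' + 1 ≤ A) :
    cost + (b + (a + 2) * f) + deathCredit K a * (f + A') ≤ X + (a + 5) * f := by
  have h1 : (a + 5) * (q + ρ) ≤ (a + 5) * (K * (b + 1)) :=
    Nat.mul_le_mul_left _ (hq.trans (Nat.mul_le_mul_left _ (by omega)))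
  have h2 : deathCredit K a * (A' + 1) ≤ deathCredit K a * A := Nat.mul_le_mul_left _ hA
  have h3 : deathCredit K a * (b + 1) = (a + 5) * (K * (b + 1)) + 4 * (b + 1) := by
    rw [deathCredit]; ring
  linarith

variable {old : List (V × V)} {ord : List V} {v w : V} {st : SearchState V}
  {L : List ((V × V) × (V × V))} {K a τ cost : ℕ}

/-- The initial threshold `v` counts as selected from the single backward candidate `v`, with none
left passive. -/
theorem SearchContext.paid_init (hK : 1 ≤ K) :
    (SearchState.init ((v, w) :: old) v w).Paid K a ord 0 0 := by
  refine ⟨∅, {v}, 0, Finset.empty_subset _, by simp [SearchState.init], by simp,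
    by simp [SearchState.init, Before.irrefl], Or.inr ⟨rfl, by simp [SearchState.init], by simp,
      by simpa using hK, by simpa using hK⟩, ?_⟩
  have h1 : ((SearchState.init ((v, w) :: old) v w).FA ∪ ∅).card ≤ 1 := by
    simp only [SearchState.init]
    split_ifs <;> simp
  have h2 : ((SearchState.init ((v, w) :: old) v w).BA ∪ {v}).card ≤ 1 := by
    simp only [SearchState.init]
    split_ifs <;> simp
  have : deathCredit K a * (((SearchState.init ((v, w) :: old) v w).FA ∪ ∅).card +
      ((SearchState.init ((v, w) :: old) v w).BA ∪ {v}).card) ≤ deathCredit K a * (1 + 1) :=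
    Nat.mul_le_mul_left _ (by omega)
  simp only [SearchState.init, Finset.card_singleton, Finset.card_empty] at this ⊢
  linarith

/-- A new vertex raises the live and the visited count alike, and an exhausted one can only lower
the live count. The 3 steps of the pass are paid by the traversal. -/
theorem SearchState.Paid.traverse {arcs : List (V × V)} {u z x y : V} {os ins : List V}
    (h : st.Paid K a ord τ cost) :
    (st.afterTraversal arcs u z x y os ins).Paid K a ord (τ + 1) (cost + 3) := by
  obtain ⟨QF, QB, ρ, hQF, hQB, h1, h2, h3, h4⟩ := h
  refine ⟨QF, QB, ρ, ?_, ?_, ?_, ?_, ?_, ?_⟩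
  · rw [afterTraversal_F]
    exact hQF.trans (Finset.subset_insert _ _)
  · rw [afterTraversal_B]
    exact hQB.trans (Finset.subset_insert _ _)
  · rwa [afterTraversal_s]
  · rwa [afterTraversal_s]
  · rwa [afterTraversal_s, afterTraversal_FP, afterTraversal_BP]
  rw [afterTraversal_FP, afterTraversal_BP]
  set st' := st.afterTraversal arcs u z x y os ins
  have hF : (st'.FA ∪ QF).card + st.F.card ≤ (st.FA ∪ QF).card + st'.F.card := by
    rw [afterTraversal_F]
    by_cases hx : x ∈ st.F
    · rw [Finset.insert_eq_of_mem hx]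
      refine Nat.add_le_add_right (Finset.card_le_card fun b => ?_) _
      simp only [Finset.mem_union, st', mem_afterTraversal_FA]
      grind
    · rw [Finset.card_insert_of_notMem hx]
      have : (st'.FA ∪ QF).card ≤ (insert x (st.FA ∪ QF)).card := by
        refine Finset.card_le_card fun b => ?_
        simp only [Finset.mem_insert, Finset.mem_union, st', mem_afterTraversal_FA]
        grind
      have := Finset.card_insert_le x (st.FA ∪ QF)
      omega
  have hB : (st'.BA ∪ QB).card + st.B.card ≤ (st.BA ∪ QB).card + st'.B.card := by
    rw [afterTraversal_B]
    by_cases hx : y ∈ st.B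
    · rw [Finset.insert_eq_of_mem hx]
      refine Nat.add_le_add_right (Finset.card_le_card fun b => ?_) _
      simp only [Finset.mem_union, st', mem_afterTraversal_BA]
      grind
    · rw [Finset.card_insert_of_notMem hx]
      have : (st'.BA ∪ QB).card ≤ (insert y (st.BA ∪ QB)).card := by
        refine Finset.card_le_card fun b => ?_
        simp only [Finset.mem_insert, Finset.mem_union, st', mem_afterTraversal_BA]
        grind
      have := Finset.card_insert_le y (st.BA ∪ QB)
      omega
  have hF' := Nat.mul_le_mul_left (deathCredit K a) hF
  have hB' := Nat.mul_le_mul_left (deathCredit K a) hB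
  linarith

/-- The 3 steps are charged to a vertex that becomes passive. It is not in `QF` or `QB`, which lie
on the active side of `s`, so it is counted as live exactly once before and after. -/
theorem SearchState.Paid.makePassive (hord : IsTotalOrder ord) (h : st.Paid K a ord τ cost)
    (hinv : SearchInv old ord v w st L) {u z : V} (hu : u ∈ st.FA) (hz : z ∈ st.BA)
    (huz : ¬ Before ord u z) : (st.makePassive ord u z).Paid K a ord τ (cost + 3) := by
  obtain ⟨QF, QB, ρ, hQF, hQB, h1, h2, h3, h4⟩ := h
  -- Here z < u, so u ≤ s ≤ z is impossible and at least one vertex becomes passive.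
  have hsz : Before ord st.s u ∨ Before ord z st.s := by
    by_contra hne
    push Not at hne
    rcases hord.before_or_before (hinv.ne_of_mem_FA hu hz) with h | h
    · exact huz h
    · simp only [Before] at *
      omega
  have hF : (((st.makePassive ord u z).FA ∪ QF).card + (if Before ord st.s u then 1 else 0) =
      (st.FA ∪ QF).card) ∧ (st.makePassive ord u z).FP.card =
      st.FP.card + (if Before ord st.s u then 1 else 0) := by
    simp only [SearchState.makePassive]
    split_ifs with h
    · have h5 : u ∉ QF := fun h' => h1 u h' h
      have h6 : st.FA.erase u ∪ QF = (st.FA ∪ QF).erase u := by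
        rw [Finset.erase_union_distrib, Finset.erase_eq_of_notMem h5]
      rw [h6, Finset.card_erase_add_one (Finset.mem_union_left _ hu),
        Finset.card_insert_of_notMem (hinv.FA_spec u hu).2.1]
      exact ⟨rfl, rfl⟩
    · exact ⟨rfl, rfl⟩
  have hB : (((st.makePassive ord u z).BA ∪ QB).card + (if Before ord z st.s then 1 else 0) =
      (st.BA ∪ QB).card) ∧ (st.makePassive ord u z).BP.card =
      st.BP.card + (if Before ord z st.s then 1 else 0) := by
    simp only [SearchState.makePassive]
    split_ifs with h
    · have h5 : z ∉ QB := fun h' => h2 z h' h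
      have h6 : st.BA.erase z ∪ QB = (st.BA ∪ QB).erase z := by
        rw [Finset.erase_union_distrib, Finset.erase_eq_of_notMem h5]
      rw [h6, Finset.card_erase_add_one (Finset.mem_union_left _ hz),
        Finset.card_insert_of_notMem (hinv.BA_spec z hz).2.1]
      exact ⟨rfl, rfl⟩
    · exact ⟨rfl, rfl⟩
  obtain ⟨hF1, hF2⟩ := hF
  obtain ⟨hB1, hB2⟩ := hB
  refine ⟨QF, QB, ρ, hQF, hQB, h1, h2, ?_, ?_⟩
  · rcases h3 with ⟨ha, hb, hc, hd, he⟩ | ⟨ha, hb, hc, hd, he⟩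
    · exact Or.inl ⟨ha, hb, by omega, hd, he⟩
    · exact Or.inr ⟨ha, hb, by omega, hd, he⟩
  · rw [← hF1, ← hB1] at h4
    have hone : 1 ≤ (if Before ord st.s u then 1 else 0) + (if Before ord z st.s then 1 else 0) := by
      rcases hsz with h | h <;> rw [if_pos h] <;> omega
    generalize (if Before ord st.s u then 1 else 0) = i at *
    generalize (if Before ord z st.s then 1 else 0) = j at *
    rw [hF2, hB2]
    change cost + 3 + _ * (_ + _ + _ + _) + _ ≤ 3 * τ + _ * (st.F.card + st.B.card) + _ + _
    linarith

/-! ### Paying for a change of threshold -/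

theorem card_erase_add_one_le {A Q : Finset V} {s : V} (hs : s ∈ Q) :
    (A.erase s).card + 1 ≤ (A ∪ Q).card := by
  rw [← Finset.card_insert_of_notMem (Finset.notMem_erase s A)]
  refine Finset.card_le_card (Finset.insert_subset (Finset.mem_union_right _ hs) ?_)
  exact (Finset.erase_subset _ _).trans Finset.subset_union_left

theorem SearchState.Paid.updateForward {ε : ℝ} {c : ℕ} {st' : SearchState V}
    (hord : IsTotalOrder ord) (hK : 1 ≤ ε * K) (h : st.Paid K a ord τ cost)
    (hinv : SearchInv old ord v w st L) (hU : UpdateForward ε a ord st (c + 1) st')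
    (hne : st'.FA ≠ ∅) : st'.Paid K a ord τ (cost + c) := by
  generalize hc : c + 1 = c' at hU
  cases hU with
  | skip =>
    obtain rfl : c = 0 := by omega
    exact h
  | kill h1 h2 => exact absurd h1 hne
  | @choose hFA hFP s d hs =>
    obtain ⟨hs1, hs2, hs3, hs4⟩ := hs.spec hord hK
    obtain ⟨QF, QB, ρ, hQF, hQB, -, -, h3, h4⟩ := h
    have hsplit := Finset.card_filter_add_card_filter_not (s := st.FP) (fun x => Before ord s x)
    -- Among the candidates weakly above `s`, only `s` itself does not remain passive; hence the `+
    -- 1`.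
    have hs5 : st.FP.card ≤ K * ((st.FP.filter fun x => Before ord s x).card + 1) := by
      refine hs3.trans (Nat.mul_le_mul_left _ (card_filter_le_card_filter_add_one (s := s) ?_))
      exact fun x hx hne => (hord.before_or_before hne).resolve_left hx
    refine ⟨st.FP.filter fun x => ¬ Before ord s x, ∅,
      (st.FP.filter fun x => Before ord s x).card,
      fun x hx => (hinv.FP_spec x (Finset.mem_filter.1 hx).1).1, by simp,
      fun x hx => (Finset.mem_filter.1 hx).2, by simp,
      Or.inl ⟨rfl, Finset.mem_filter.2 ⟨hs1, Before.irrefl⟩, le_rfl, by omega, by omega⟩, ?_⟩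
    -- The old debt is settled and replaced by one of `a + 5` per current candidate. The 3 owed for
    -- each passive forward vertex moves into it, and subtracting `3 * ρ` keeps it from being
    -- counted twice.
    have key : cost + (st.BP.card + (a + 2) * st.FP.card) +
        deathCredit K a * (st.FP.card + (st.BA.erase st.s).card) ≤
        3 * τ + deathCredit K a * (st.F.card + st.B.card) + (a + 5) * st.FP.card := by
      rw [hFA, Finset.empty_union] at h4
      rcases h3 with ⟨rfl, hb, hc, hd, he⟩ | ⟨rfl, hb, hc, hd, he⟩
      · refine pays_of_exhausted (q := QF.card) (ρ := ρ) (A := st.BA.card) ?_ hd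
          (Finset.card_le_card (Finset.erase_subset _ _))
        rw [Finset.union_empty, Finset.card_empty] at h4
        linarith
      · refine pays_of_opposite (q := QB.card) (ρ := ρ) (A := (st.BA ∪ QB).card) ?_ he hc
          (card_erase_add_one_le hb)
        rw [Finset.card_empty] at h4
        linarith
    simp only [Finset.union_idempotent, Finset.union_empty, Finset.card_empty]
    rw [← hsplit] at key hs4 hc
    linarith

theorem SearchState.Paid.updateBackward {ε : ℝ} {c : ℕ} {st' : SearchState V}
    (hord : IsTotalOrder ord) (hK : 1 ≤ ε * K) (h : st.Paid K a ord τ cost)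
    (hinv : SearchInv old ord v w st L) (hU : UpdateBackward ε a ord st (c + 1) st')
    (hne : st'.BA ≠ ∅) : st'.Paid K a ord τ (cost + c) := by
  generalize hc : c + 1 = c' at hU
  cases hU with
  | skip =>
    obtain rfl : c = 0 := by omega
    exact h
  | kill h1 h2 => exact absurd h1 hne
  | @choose hBA hBP s d hs =>
    obtain ⟨hs1, hs2, hs3, hs4⟩ := hs.spec hord hK
    obtain ⟨QF, QB, ρ, hQF, hQB, -, -, h3, h4⟩ := h
    have hsplit := Finset.card_filter_add_card_filter_not (s := st.BP) (fun x => Before ord x s)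
    have hs5 : st.BP.card ≤ K * ((st.BP.filter fun x => Before ord x s).card + 1) := by
      refine hs2.trans (Nat.mul_le_mul_left _ (card_filter_le_card_filter_add_one (s := s) ?_))
      exact fun x hx hne => (hord.before_or_before hne).resolve_right hx
    refine ⟨∅, st.BP.filter fun x => ¬ Before ord x s,
      (st.BP.filter fun x => Before ord x s).card, by simp,
      fun x hx => (hinv.BP_spec x (Finset.mem_filter.1 hx).1).1, by simp,
      fun x hx => (Finset.mem_filter.1 hx).2,
      Or.inr ⟨rfl, Finset.mem_filter.2 ⟨hs1, Before.irrefl⟩, le_rfl, by omega, by omega⟩, ?_⟩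
    have key : cost + (st.FP.card + (a + 2) * st.BP.card) +
        deathCredit K a * (st.BP.card + (st.FA.erase st.s).card) ≤
        3 * τ + deathCredit K a * (st.F.card + st.B.card) + (a + 5) * st.BP.card := by
      rw [hBA, Finset.empty_union] at h4
      rcases h3 with ⟨rfl, hb, hc, hd, he⟩ | ⟨rfl, hb, hc, hd, he⟩
      · refine pays_of_opposite (q := QF.card) (ρ := ρ) (A := (st.FA ∪ QF).card) ?_ he hc
          (card_erase_add_one_le hb)
        rw [Finset.card_empty] at h4
        linarith
      · refine pays_of_exhausted (q := QB.card) (ρ := ρ) (A := st.FA.card) ?_ hd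
          (Finset.card_le_card (Finset.erase_subset _ _))
        rw [Finset.union_empty, Finset.card_empty] at h4
        linarith
    simp only [Finset.union_idempotent, Finset.union_empty, Finset.card_empty]
    rw [← hsplit] at key hs4 hc
    linarith

theorem SearchInv.card_FP_le (h : SearchInv old ord v w st L) : st.FP.card ≤ L.length + 1 :=
  (Finset.card_le_card fun x hx => (h.FP_spec x hx).1).trans h.card_F

theorem SearchInv.card_BP_le (h : SearchInv old ord v w st L) : st.BP.card ≤ L.length + 1 :=
  (Finset.card_le_card fun x hx => (h.BP_spec x hx).1).trans h.card_B

/-- The time of a search per traversal. -/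
def searchFactor (K a : ℕ) : ℕ := 2 * deathCredit K a + 5 * a + 40

/-- The reserve `(2 * a + 6) * (τ + 1)` covers both updates of a pass that empties a side, after
which `Paid` is no longer maintained. -/
theorem SearchState.Paid.le (hinv : SearchInv old ord v w st L) (h : st.Paid K a ord τ cost)
    (hτ : τ = L.length) : cost + (2 * a + 6) * (τ + 1) ≤ searchFactor K a * (τ + 1) := by
  obtain ⟨QF, QB, ρ, hQF, hQB, -, -, h3, h4⟩ := h
  have h5 := hinv.card_FP_le
  have h6 := hinv.card_BP_le
  have h7 := (Finset.card_le_card hQF).trans hinv.card_F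
  have h8 := (Finset.card_le_card hQB).trans hinv.card_B
  have h9 : QF.card + QB.card + ρ ≤ 2 * (τ + 1) := by
    rcases h3 with ⟨rfl, -, hc, -⟩ | ⟨rfl, -, hc, -⟩ <;> rw [Finset.card_empty] <;> omega
  have h10 : (a + 5) * (QF.card + QB.card + ρ) ≤ (a + 5) * (2 * (τ + 1)) :=
    Nat.mul_le_mul_left _ h9
  have h11 : deathCredit K a * (st.F.card + st.B.card) ≤ deathCredit K a * (2 * (τ + 1)) :=
    Nat.mul_le_mul_left _ (by have := hinv.card_F; have := hinv.card_B; omega)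
  have h12 : cost ≤ 3 * τ + deathCredit K a * (2 * (τ + 1)) + (a + 5) * (2 * (τ + 1)) +
      3 * (2 * (τ + 1)) := by
    have : 3 * (st.FP.card + st.BP.card) ≤ 3 * (2 * (τ + 1)) := by omega
    have := Nat.zero_le (deathCredit K a *
        ((st.FA ∪ QF).card + st.FP.card + (st.BA ∪ QB).card + st.BP.card))
    omega
  have : 0 ≤ a * τ := Nat.zero_le _
  rw [searchFactor]
  linarith

theorem UpdateForward.time_le {ε : ℝ} {c : ℕ} {st' : SearchState V} (hord : IsTotalOrder ord)
    (hK : 1 ≤ ε * K) (hinv : SearchInv old ord v w st L) (hU : UpdateForward ε a ord st c st') :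
    ∃ c', c = c' + 1 ∧ c' ≤ (a + 3) * (L.length + 1) := by
  have h5 := hinv.card_FP_le
  have h6 := hinv.card_BP_le
  have : 0 ≤ a * (L.length + 1) := Nat.zero_le _
  cases hU with
  | skip => exact ⟨0, rfl, Nat.zero_le _⟩
  | kill => exact ⟨_, Nat.add_comm _ _, by linarith⟩
  | @choose _ _ s d hs =>
    obtain ⟨-, -, -, hs4⟩ := hs.spec hord hK
    have : a * st.FP.card ≤ a * (L.length + 1) := Nat.mul_le_mul_left _ h5
    exact ⟨st.BP.card + d + st.FP.card, by omega, by linarith⟩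

theorem UpdateBackward.time_le {ε : ℝ} {c : ℕ} {st' : SearchState V} (hord : IsTotalOrder ord)
    (hK : 1 ≤ ε * K) (hinv : SearchInv old ord v w st L) (hU : UpdateBackward ε a ord st c st') :
    ∃ c', c = c' + 1 ∧ c' ≤ (a + 3) * (L.length + 1) := by
  have h5 := hinv.card_FP_le
  have h6 := hinv.card_BP_le
  have : 0 ≤ a * (L.length + 1) := Nat.zero_le _
  cases hU with
  | skip => exact ⟨0, rfl, Nat.zero_le _⟩
  | kill => exact ⟨_, Nat.add_comm _ _, by linarith⟩
  | @choose _ _ s d hs =>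
    obtain ⟨-, -, -, hs4⟩ := hs.spec hord hK
    have : a * st.BP.card ≤ a * (L.length + 1) := Nat.mul_le_mul_left _ h6
    exact ⟨st.FP.card + d + st.BP.card, by omega, by linarith⟩

/-- The invariant of a search, with the time `cost` used so far. -/
structure SearchGood (K a : ℕ) (old : List (V × V)) (ord : List V) (v w : V) (st : SearchState V)
    (L : List ((V × V) × (V × V))) (cost : ℕ) : Prop where
  inv : SearchInv old ord v w st L
  empty_FP : st.FA = ∅ → st.FP = ∅
  empty_BP : st.BA = ∅ → st.BP = ∅
  paid : st.FA ≠ ∅ → st.BA ≠ ∅ → st.Paid K a ord L.length cost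
  cost_le : cost ≤ searchFactor K a * (L.length + 1)

theorem SearchContext.searchGood_init (hc : SearchContext old ord v w) (hK : 1 ≤ K) :
    SearchGood K a old ord v w (SearchState.init ((v, w) :: old) v w) [] 0 where
  inv := hc.searchInv_init
  empty_FP _ := rfl
  empty_BP _ := rfl
  paid _ _ := SearchContext.paid_init hK
  cost_le := Nat.zero_le _

theorem UpdateForward.empty_FP {ε : ℝ} {c : ℕ} {st' : SearchState V}
    (hU : UpdateForward ε a ord st c st') (h : st'.FA = ∅) : st'.FP = ∅ := by
  cases hU with
  | skip h' => exact absurd h h'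
  | kill _ h' => exact h'
  | choose _ _ hs => exact absurd h (Finset.ne_empty_of_mem
      (Finset.mem_filter.2 ⟨hs.mem, Before.irrefl⟩))

theorem UpdateBackward.empty {ε : ℝ} {c : ℕ} {st' : SearchState V}
    (hU : UpdateBackward ε a ord st c st') (h : st.FA = ∅ → st.FP = ∅) :
    (st'.FA = ∅ → st'.FP = ∅) ∧ (st'.BA = ∅ → st'.BP = ∅) := by
  cases hU with
  | skip h' => exact ⟨h, fun h'' => absurd h'' h'⟩
  | kill _ h' => exact ⟨fun _ => rfl, fun _ => h'⟩
  | choose _ _ hs => exact ⟨fun _ => rfl, fun h => absurd h (Finset.ne_empty_of_mem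
      (Finset.mem_filter.2 ⟨hs.mem, Before.irrefl⟩))⟩

theorem UpdateBackward.FA_subset {ε : ℝ} {c : ℕ} {st' : SearchState V}
    (hU : UpdateBackward ε a ord st c st') : st'.FA ⊆ st.FA := by
  cases hU with
  | skip => exact subset_rfl
  | kill => exact Finset.erase_subset _ _
  | choose => exact Finset.erase_subset _ _

theorem SearchGood.loop {ε : ℝ} {st₁ st₂ st₃ : SearchState V} {c d : ℕ}
    (hc : SearchContext old ord v w) (hK : 1 ≤ ε * K) (h : SearchGood K a old ord v w st L cost)
    (hs : SearchStep ((v, w) :: old) ord st (.inl st₁)) (hF : UpdateForward ε a ord st₁ c st₂)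
    (hB : UpdateBackward ε a ord st₂ d st₃) :
    ∃ L', SearchGood K a old ord v w st₃ L' (cost + (1 + c + d)) := by
  have hord := hc.topological.1
  obtain ⟨L', hinv, hpaid⟩ : ∃ L', SearchInv old ord v w st₁ L' ∧
      st₁.Paid K a ord L'.length (cost + 3) := by
    cases hs with
    | traverse hu hz huz hout hin hx hy =>
      push Not at hy
      exact ⟨_, h.inv.traverse hc hu hz huz hout hin hx hy.1 hy.2,
        (h.paid (Finset.ne_empty_of_mem hu) (Finset.ne_empty_of_mem hz)).traverse⟩
    | passive hu hz huz =>
      exact ⟨L, h.inv.makePassive hu hz,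
        (h.paid (Finset.ne_empty_of_mem hu) (Finset.ne_empty_of_mem hz)).makePassive hord h.inv
          hu hz huz⟩
  have hinv₂ := hinv.updateForward hF
  obtain ⟨c, rfl, hc'⟩ := hF.time_le hord hK hinv
  obtain ⟨d, rfl, hd'⟩ := hB.time_le hord hK hinv₂
  have hE := hB.empty hF.empty_FP
  refine ⟨L', hinv₂.updateBackward hB, hE.1, hE.2, fun hFA hBA => ?_, ?_⟩
  -- The backward update cannot create active forward vertices, so the forward update was not of the
  -- killing kind.
  · have hFA₂ : st₂.FA ≠ ∅ := fun h' => hFA (Finset.subset_empty.1 (h' ▸ hB.FA_subset))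
    have := (hpaid.updateForward hord hK hinv hF hFA₂).updateBackward hord hK hinv₂ hB hBA
    rwa [show cost + (1 + (c + 1) + (d + 1)) = cost + 3 + c + d by omega]
  · have := hpaid.le hinv rfl
    linarith

end SearchCost

section Correctness

variable {V : Type*} [DecidableEq V]

/-! ## Reported cycles and the end of a search -/

variable {old : List (V × V)} {ord : List V} {v w : V} {st : SearchState V}
  {L : List ((V × V) × (V × V))} {K a cost : ℕ}

theorem SearchInv.report (h : SearchInv old ord v w st L) {b : V × V}
    (hs : SearchStep ((v, w) :: old) ord st (.inr b)) :
    Arc old b.1 b.2 ∧ Relation.ReflTransGen (Arc old) w b.1 ∧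
      Relation.ReflTransGen (Arc old) b.2 v := by
  cases hs with
  | @returnForward u z x y os ins hu hz huz hout hin hx =>
    have huF := (h.FA_spec u hu).1
    exact ⟨h.out_sub u huF x (by simp [hout]), h.reach_F u huF, h.reach_B x hx⟩
  | @returnBackward u z x y os ins hu hz huz hout hin hx hy =>
    have huF := (h.FA_spec u hu).1
    have hzB := (h.BA_spec z hz).1
    refine ⟨h.inp_sub z hzB y (by simp [hin]), ?_, h.reach_B z hzB⟩
    rcases hy with hy | rfl
    · exact h.reach_F y hy
    · exact (h.reach_F u huF).tail (h.out_sub u huF y (by simp [hout]))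

/-- No arc is traversed forward twice. This alone bounds a search that is unfinished or ends in a
report. -/
theorem SearchInv.length_le (h : SearchInv old ord v w st L) : L.length ≤ old.length := by
  have := (h.nodup_fst.subperm fun p hp => (h.pairs_fst p hp).1).length_le
  simpa using this

/-- The exhausted side has no active and hence no passive vertices, so `live` leaves no such pair.
-/
theorem SearchGood.not_before (h : SearchGood K a old ord v w st L cost)
    (hend : st.FA = ∅ ∨ st.BA = ∅) {x y : V} (hx : x ∈ st.F) (hy : y ∈ st.B)
    (hxo : st.out x ≠ []) (hyi : st.inp y ≠ []) : ¬ Before ord x y := by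
  intro hxy
  have h1 := h.inv.live x hx y hy hxo hyi hxy
  have h2 := h.empty_FP
  have h3 := h.empty_BP
  grind

theorem IsTopologicalOrder.before_of_transGen {arcs : List (V × V)}
    (h : IsTopologicalOrder arcs ord) {x y : V} (hxy : Relation.TransGen (Arc arcs) x y) :
    Before ord x y := by
  induction hxy with
  | single h' => exact h.2 _ _ h'
  | tail _ h' ih => exact ih.trans (h.2 _ _ h')

theorem IsTopologicalOrder.acyclic {arcs : List (V × V)} (h : IsTopologicalOrder arcs ord) :
    Acyclic arcs := fun _ hx => Before.irrefl (h.before_of_transGen hx)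

theorem IsTopologicalOrder.not_before {arcs : List (V × V)}
    (h : IsTopologicalOrder arcs ord) {x y : V} (hxy : Relation.ReflTransGen (Arc arcs) x y) :
    ¬ Before ord y x := by
  rcases Relation.reflTransGen_iff_eq_or_transGen.1 hxy with rfl | hxy
  · exact Before.irrefl
  · exact (h.before_of_transGen hxy).asymm

/-! ## Reordering -/

theorem SearchInv.mem_F_of_arc (h : SearchInv old ord v w st L) {x y : V} (hx : x ∈ st.F)
    (hxo : st.out x = []) (hxy : (x, y) ∈ old) : y ∈ st.F := by
  rcases h.traversed_out x hx y hxy with h' | h'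
  · simp [hxo] at h'
  · exact (h.pairs_fst _ h').2.2.1

theorem SearchInv.mem_B_of_arc (h : SearchInv old ord v w st L) {x y : V} (hy : y ∈ st.B)
    (hyi : st.inp y = []) (hxy : (x, y) ∈ old) : x ∈ st.B := by
  rcases h.traversed_inp y hy x hxy with h' | h'
  · simp [hyi] at h'
  · exact (h.pairs_snd _ h').2.1

theorem SearchInv.ne_of_mem_F (h : SearchInv old ord v w st L) {x : V} (hx : x ∈ st.F) :
    x ≠ v := fun e => h.disjoint x hx (e ▸ h.mem_B)

theorem SearchInv.ne_of_mem_B (h : SearchInv old ord v w st L) {x : V} (hx : x ∈ st.B) :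
    x ≠ w := fun e => h.disjoint w h.mem_F (e ▸ hx)

/-- Every arc out of an exhausted forward vertex has been traversed forward, so these arcs inject
into the traversals. -/
theorem SearchInv.sum_outList_le (hc : SearchContext old ord v w)
    (h : SearchInv old ord v w st L) {S : Finset V} (hS : ∀ x ∈ S, x ∈ st.F ∧ st.out x = []) :
    ∑ x ∈ S, (outList ((v, w) :: old) x).length ≤ L.length := by
  calc ∑ x ∈ S, (outList ((v, w) :: old) x).length
      = ∑ x ∈ S, (outList ((v, w) :: old) x).toFinset.card :=
        Finset.sum_congr rfl fun x _ =>
          (List.toFinset_card_of_nodup (nodup_outList hc.nodup_cons x)).symm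
    _ = (S.sigma fun x => (outList ((v, w) :: old) x).toFinset).card := (Finset.card_sigma _ _).symm
    _ ≤ (L.map Prod.fst).toFinset.card := by
        refine Finset.card_le_card_of_injOn (fun p => (p.1, p.2)) ?_ ?_
        · rintro ⟨x, y⟩ hp
          simp only [Finset.mem_coe, Finset.mem_sigma, List.mem_toFinset] at hp ⊢
          obtain ⟨hx, hxo⟩ := hS x hp.1
          rw [mem_outList_cons (h.ne_of_mem_F hx)] at hp
          exact (h.traversed_out x hx y hp.2).resolve_left (by simp [hxo])
        · rintro ⟨x, y⟩ - ⟨x', y'⟩ - h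
          simp only [Prod.mk.injEq] at h
          obtain ⟨rfl, rfl⟩ := h
          rfl
    _ ≤ L.length := (List.toFinset_card_le _).trans (by simp)

theorem SearchInv.sum_inList_le (hc : SearchContext old ord v w)
    (h : SearchInv old ord v w st L) {S : Finset V} (hS : ∀ x ∈ S, x ∈ st.B ∧ st.inp x = []) :
    ∑ x ∈ S, (inList ((v, w) :: old) x).length ≤ L.length := by
  calc ∑ x ∈ S, (inList ((v, w) :: old) x).length
      = ∑ x ∈ S, (inList ((v, w) :: old) x).toFinset.card :=
        Finset.sum_congr rfl fun x _ =>
          (List.toFinset_card_of_nodup (nodup_inList hc.nodup_cons x)).symm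
    _ = (S.sigma fun x => (inList ((v, w) :: old) x).toFinset).card := (Finset.card_sigma _ _).symm
    _ ≤ (L.map Prod.snd).toFinset.card := by
        refine Finset.card_le_card_of_injOn (fun p => (p.2, p.1)) ?_ ?_
        · rintro ⟨y, x⟩ hp
          simp only [Finset.mem_coe, Finset.mem_sigma, List.mem_toFinset] at hp ⊢
          obtain ⟨hy, hyi⟩ := hS y hp.1
          rw [mem_inList_cons (h.ne_of_mem_B hy)] at hp
          exact (h.traversed_inp y hy x hp.2).resolve_left (by simp [hyi])
        · rintro ⟨x, y⟩ - ⟨x', y'⟩ - h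
          simp only [Prod.mk.injEq] at h
          obtain ⟨rfl, rfl⟩ := h
          rfl
    _ ≤ L.length := (List.toFinset_card_le _).trans (by simp)

/-- As `v` is not forward, the new arc does not occur, and the old position is a potential for the
sorting. -/
theorem SearchInv.lt_of_mem_outList (hc : SearchContext old ord v w)
    (h : SearchInv old ord v w st L) {S : Finset V} (hS : S ⊆ st.F) :
    ∀ x ∈ S, ∀ y ∈ outList ((v, w) :: old) x, (ord.idxOf x : ℤ) < ord.idxOf y := by
  intro x hx y hy
  rw [mem_outList_cons (h.ne_of_mem_F (hS hx))] at hy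
  exact_mod_cast hc.topological.2 x y hy

theorem SearchInv.lt_of_mem_inList (hc : SearchContext old ord v w)
    (h : SearchInv old ord v w st L) {S : Finset V} (hS : S ⊆ st.B) :
    ∀ y ∈ S, ∀ x ∈ inList ((v, w) :: old) y, -(ord.idxOf y : ℤ) < -ord.idxOf x := by
  intro y hy x hx
  rw [mem_inList_cons (h.ne_of_mem_B (hS hy))] at hx
  have : ord.idxOf x < ord.idxOf y := hc.topological.2 x y hx
  omega

theorem SearchInv.exists_reorder (hc : SearchContext old ord v w)
    (h : SearchInv old ord v w st L) : ∃ c ord', Reorder ((v, w) :: old) ord v st c ord' := by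
  obtain ⟨t, ht, hmin⟩ := (insert v (st.F.filter fun x => st.out x ≠ [])).exists_min_image
    (fun x => ord.idxOf x) (Finset.insert_nonempty _ _)
  have hpivot : IsPivot ord v st t := by
    simp only [Finset.mem_insert, Finset.mem_filter] at ht hmin
    exact ⟨ht, (hmin v (Or.inl rfl)).not_gt, fun x hx hxo => (hmin x (Or.inr ⟨hx, hxo⟩)).not_gt⟩
  obtain ⟨fs, c, hfs⟩ := TopSort.exists (h.lt_of_mem_outList hc
    (S := forwardBelow ord st t) (Finset.filter_subset _ _))
  obtain ⟨bs, d, hbs⟩ := TopSort.exists (h.lt_of_mem_inList hc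
    (S := backwardAbove ord st t) (Finset.filter_subset _ _))
  by_cases htv : t = v
  · subst htv
    exact ⟨_, _, .after hpivot hfs⟩
  · exact ⟨_, _, .before hpivot htv hfs hbs⟩

/-- The moved set contains `w`, and arcs out of it stay in `F`, so they end in the moved set or
beyond `v`. An old arc into it starts below `v`, where its tail stays. -/
theorem SearchInv.isTopologicalOrder_after (hc : SearchContext old ord v w)
    (h : SearchInv old ord v w st L) {fs : List V}
    (hnodup : fs.Nodup) (hmem : ∀ x, x ∈ fs ↔ x ∈ forwardBelow ord st v)
    (hsorted : fs.Pairwise fun x y => x ∉ outList ((v, w) :: old) y)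
    (hout : ∀ x ∈ fs, st.out x = []) :
    IsTopologicalOrder ((v, w) :: old) (fs.reverse.foldl (moveAfter v) ord) := by
  have hmem' (x) : x ∈ fs ↔ x ∈ st.F ∧ Before ord x v := by rw [hmem, forwardBelow, Finset.mem_filter]
  have hv : v ∉ fs := by simp [hmem', Before.irrefl]
  obtain ⟨h1, h2, h3, h4⟩ := foldl_moveAfter fs.reverse hc.topological.1
    (List.nodup_reverse.2 hnodup) (by simpa using hv)
  simp only [List.mem_reverse, List.pairwise_reverse] at h2 h3 h4
  set ord' := fs.reverse.foldl (moveAfter v) ord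
  have hw : w ∈ fs := (hmem' w).2 ⟨h.mem_F, hc.before⟩
  refine ⟨h1, fun x y hxy => ?_⟩
  by_cases hx : x ∈ fs
  · have hxF := ((hmem' x).1 hx).1
    have hxy' : (x, y) ∈ old := (mem_outList_cons (h.ne_of_mem_F hxF)).1 (mem_outList.2 hxy)
    by_cases hy : y ∈ fs
    · exact rel_of_pairwise h4 hsorted hx hy (mem_outList.2 hxy) (hc.topological.2 x y hxy').ne
    · rw [h3 y x hy hx]
      have hyF := h.mem_F_of_arc hxF (hout x hx) hxy'
      exact (hc.topological.1.before_or_before (h.ne_of_mem_F hyF)).resolve_left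
        fun h' => hy ((hmem' y).2 ⟨hyF, h'⟩)
  · by_cases hy : y ∈ fs
    · refine (h1.before_or_before (by rintro rfl; exact hx hy)).resolve_right fun h' => ?_
      rw [h3 x y hx hy] at h'
      have hne : x ≠ v := h'.ne.symm
      have hxy' : (x, y) ∈ old := (mem_outList_cons hne).1 (mem_outList.2 hxy)
      exact ((hc.topological.2 x y hxy').trans ((hmem' y).1 hy).2).asymm h'
    · rw [h2 x y hx hy]
      rcases List.mem_cons.1 hxy with e | hxy
      · obtain ⟨rfl, rfl⟩ := Prod.mk.inj e
        exact (hy hw).elim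
      · exact hc.topological.2 x y hxy

/-- The final arrangement is B_>, F_<, t. Arcs out of F_< stay in `F` and arcs into B_> come from
`B`, because the vertices concerned are exhausted; the new arc starts in B_>. -/
theorem SearchInv.isTopologicalOrder_before (hc : SearchContext old ord v w)
    (h : SearchInv old ord v w st L) {fs bs : List V} {t : V} (htF : t ∈ st.F)
    (htv : Before ord t v)     (hfs : fs.Nodup) (hmf : ∀ x, x ∈ fs ↔ x ∈ forwardBelow ord st t)
    (hsf : fs.Pairwise fun x y => x ∉ outList ((v, w) :: old) y)
    (hout : ∀ x ∈ fs, st.out x = [])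
    (hbs : bs.Nodup) (hmb : ∀ x, x ∈ bs ↔ x ∈ backwardAbove ord st t)
    (hsb : bs.Pairwise fun x y => x ∉ inList ((v, w) :: old) y)
    (hinp : ∀ x ∈ bs, st.inp x = []) :
    IsTopologicalOrder ((v, w) :: old)
      (fs.foldl (moveBefore t) (bs.reverse.foldl (moveBefore t) ord)) := by
  have hmf' (x) : x ∈ fs ↔ x ∈ st.F ∧ Before ord x t := by rw [hmf, forwardBelow, Finset.mem_filter]
  have hmb' (x) : x ∈ bs ↔ x ∈ st.B ∧ Before ord t x := by
    rw [hmb, backwardAbove, Finset.mem_filter]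
  have hord := hc.topological.1
  have htf : t ∉ fs := by simp [hmf', Before.irrefl]
  have htb : t ∉ bs := by simp [hmb', Before.irrefl]
  have hdisj : ∀ x ∈ st.F, x ∉ bs := fun x hx hx' => h.disjoint x hx ((hmb' x).1 hx').1
  obtain ⟨h1, h2, h3, h4⟩ := foldl_moveBefore bs.reverse hord
    (List.nodup_reverse.2 hbs) (by simpa using htb)
  simp only [List.mem_reverse] at h2 h3
  set ord₁ := bs.reverse.foldl (moveBefore t) ord
  obtain ⟨h1', h2', h3', h4'⟩ := foldl_moveBefore fs h1 hfs htf
  set ord' := fs.foldl (moveBefore t) ord₁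
  have hbt : ∀ x ∈ bs, Before ord₁ x t := fun x hx =>
    (h1.before_or_before (by rintro rfl; exact htb hx)).resolve_right fun h' =>
      Before.irrefl ((h3 t x htb hx).1 h')
  have hsb' : bs.reverse.Pairwise fun x y => x ∉ outList ((v, w) :: old) y := by
    rw [List.pairwise_reverse]
    simpa only [mem_outList, mem_inList] using hsb
  have hvb : v ∈ bs := (hmb' v).2 ⟨h.mem_B, htv⟩
  refine ⟨h1', fun x y hxy => ?_⟩
  by_cases hx : x ∈ fs
  · have hxF := ((hmf' x).1 hx).1
    have hxy' : (x, y) ∈ old := (mem_outList_cons (h.ne_of_mem_F hxF)).1 (mem_outList.2 hxy)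
    by_cases hy : y ∈ fs
    · exact rel_of_pairwise h4' hsf hx hy (mem_outList.2 hxy) (hc.topological.2 x y hxy').ne
    · have hyF := h.mem_F_of_arc hxF (hout x hx) hxy'
      refine (h1'.before_or_before (by rintro rfl; exact hy hx)).resolve_right fun h' => ?_
      rw [h3' y x hy hx, h2 y t (hdisj y hyF) htb] at h'
      exact hy ((hmf' y).2 ⟨hyF, h'⟩)
  -- An arc out of B_> that misses F_< cannot end below `t`: the new arc would end in F_<, and an
  -- old arc goes upward from beyond `t`.
  have hvw : y ∉ fs → x ∈ bs → Before ord y t → False := by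
    intro hy hxb hyt
    rcases List.mem_cons.1 hxy with e | hxy
    · obtain ⟨rfl, rfl⟩ := Prod.mk.inj e
      exact hy ((hmf' _).2 ⟨h.mem_F, hyt⟩)
    · exact (hyt.trans ((hmb' x).1 hxb).2).asymm (hc.topological.2 x y hxy)
  by_cases hxb : x ∈ bs
  · by_cases hy : y ∈ fs
    · exact (h3' x y hx hy).2 (hbt x hxb)
    · rw [h2' x y hx hy]
      by_cases hyb : y ∈ bs
      · have hyB := ((hmb' y).1 hyb).1
        have hxy' : (x, y) ∈ old := (mem_inList_cons (h.ne_of_mem_B hyB)).1 (mem_inList.2 hxy)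
        exact rel_of_pairwise h4 hsb' (List.mem_reverse.2 hxb) (List.mem_reverse.2 hyb)
          (mem_outList.2 hxy) (hc.topological.2 x y hxy').ne
      · refine (h1.before_or_before (by rintro rfl; exact hyb hxb)).resolve_right fun h' => ?_
        exact hvw hy hxb ((h3 y x hyb hxb).1 h')
  · have hxy' : (x, y) ∈ old :=
      (mem_outList_cons (by rintro rfl; exact hxb hvb)).1 (mem_outList.2 hxy)
    have hb := hc.topological.2 x y hxy'
    by_cases hy : y ∈ fs
    · exact (h3' x y hx hy).2 ((h2 x t hxb htb).2 (hb.trans ((hmf' y).1 hy).2))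
    · rw [h2' x y hx hy]
      by_cases hyb : y ∈ bs
      · rw [h3 x y hxb hyb]
        have hxB := h.mem_B_of_arc ((hmb' y).1 hyb).1 (hinp y hyb) hxy'
        exact (hord.before_or_before (by rintro rfl; exact h.disjoint _ htF hxB)).resolve_right
          fun h' => hxb ((hmb' x).2 ⟨hxB, h'⟩)
      · exact (h2 x y hxb hyb).2 hb

end Correctness

theorem reflTransGen_cons {V : Type*} {arcs : List (V × V)} {x y : V} (b : V × V)
    (h : Relation.ReflTransGen (Arc arcs) x y) : Relation.ReflTransGen (Arc (b :: arcs)) x y :=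
  Relation.ReflTransGen.mono (fun _ _ => List.mem_cons_of_mem b) _ _ h

section Main

variable {V : Type*} [DecidableEq V]

variable {old : List (V × V)} {ord : List V} {v w : V} {st : SearchState V}
  {L : List ((V × V) × (V × V))} {K a cost : ℕ}

/-- Minimality of `t` makes every vertex of F_< exhausted. If `t ≠ v`, then `t` is a forward vertex
with an untraversed arc, so `SearchGood.not_before` makes every vertex of B_> exhausted. -/
theorem SearchGood.reorder (hc : SearchContext old ord v w)
    (h : SearchGood K a old ord v w st L cost) (hend : st.FA = ∅ ∨ st.BA = ∅) {c : ℕ}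
    {ord' : List V} (hR : Reorder ((v, w) :: old) ord v st c ord') :
    IsTopologicalOrder ((v, w) :: old) ord' ∧ c ≤ 22 * (L.length + 1) := by
  have hF := h.inv.card_F
  have hB := h.inv.card_B
  cases hR with
  | @after fs c ht hfs =>
    have hsub : forwardBelow ord st v ⊆ st.F := Finset.filter_subset _ _
    have hout : ∀ x ∈ forwardBelow ord st v, x ∈ st.F ∧ st.out x = [] := by
      intro x hx
      obtain ⟨hxF, hxv⟩ := Finset.mem_filter.1 hx
      exact ⟨hxF, not_not.1 fun hne => ht.2.2 x hxF hne hxv⟩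
    obtain ⟨h1, h2, h3, h4, h5⟩ := hfs.spec (h.inv.lt_of_mem_outList hc hsub)
    have hsum := h.inv.sum_outList_le hc hout
    have hcard := Finset.card_le_card hsub
    exact ⟨h.inv.isTopologicalOrder_after hc h1 h2 h3 fun x hx => (hout x ((h2 x).1 hx)).2,
      by omega⟩
  | @before t fs bs c d ht htv hfs hbs =>
    obtain ⟨htF, hto⟩ := ht.1.resolve_left htv
    have htv' : Before ord t v := (hc.topological.1.before_or_before htv).resolve_right ht.2.1
    have hsubF : forwardBelow ord st t ⊆ st.F := Finset.filter_subset _ _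
    have hsubB : backwardAbove ord st t ⊆ st.B := Finset.filter_subset _ _
    have hout : ∀ x ∈ forwardBelow ord st t, x ∈ st.F ∧ st.out x = [] := by
      intro x hx
      obtain ⟨hxF, hxt⟩ := Finset.mem_filter.1 hx
      exact ⟨hxF, not_not.1 fun hne => ht.2.2 x hxF hne hxt⟩
    have hinp : ∀ y ∈ backwardAbove ord st t, y ∈ st.B ∧ st.inp y = [] := by
      intro y hy
      obtain ⟨hyB, hty⟩ := Finset.mem_filter.1 hy
      exact ⟨hyB, not_not.1 fun hne => h.not_before hend htF hyB hto hne hty⟩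
    obtain ⟨h1, h2, h3, h4, h5⟩ := hfs.spec (h.inv.lt_of_mem_outList hc hsubF)
    obtain ⟨h1', h2', h3', h4', h5'⟩ := hbs.spec (h.inv.lt_of_mem_inList hc hsubB)
    have hsumF := h.inv.sum_outList_le hc hout
    have hsumB := h.inv.sum_inList_le hc hinp
    have hcardF := Finset.card_le_card hsubF
    have hcardB := Finset.card_le_card hsubB
    exact ⟨h.inv.isTopologicalOrder_before hc htF htv' h1 h2 h3
      (fun x hx => (hout x ((h2 x).1 hx)).2) h1' h2' h3'
      (fun x hx => (hinp x ((h2' x).1 hx)).2), by omega⟩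

/-! ## Related pairs of arcs -/

open Classical in
/-- The pairs of arcs that lie in this order on a path. -/
noncomputable def relatedPairs (arcs : List (V × V)) : Finset ((V × V) × (V × V)) :=
  (arcs.toFinset ×ˢ arcs.toFinset).filter fun p => Relation.ReflTransGen (Arc arcs) p.1.2 p.2.1

theorem card_relatedPairs_le (arcs : List (V × V)) :
    (relatedPairs arcs).card ≤ arcs.length * arcs.length := by
  classical
  refine (Finset.card_filter_le _ _).trans ?_
  rw [Finset.card_product]
  exact Nat.mul_le_mul (List.toFinset_card_le _) (List.toFinset_card_le _)

theorem relatedPairs_subset_cons (arcs : List (V × V)) (b : V × V) :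
    relatedPairs arcs ⊆ relatedPairs (b :: arcs) := by
  intro p
  simp only [relatedPairs, Finset.mem_filter, Finset.mem_product, List.mem_toFinset]
  rintro ⟨⟨h1, h2⟩, h3⟩
  exact ⟨⟨List.mem_cons_of_mem _ h1, List.mem_cons_of_mem _ h2⟩,
    reflTransGen_cons b h3⟩

/-- The combinatorial core: at least half of the τ² ordered pairs of traversals yield distinct pairs
of arcs that become related only through the new arc. -/
theorem SearchInv.sq_le_relatedPairs (hc : SearchContext old ord v w)
    (h : SearchInv old ord v w st L) :
    L.length * L.length + 2 * (relatedPairs old).card ≤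
      2 * (relatedPairs ((v, w) :: old)).card := by
  set A := L.toFinset with hA
  have hcardA : A.card = L.length := List.toFinset_card_of_nodup (List.Nodup.of_map _ h.nodup_fst)
  set W := (A ×ˢ A).filter fun p => Before ord p.1.1.1 p.2.2.2 with hW
  have h1 : A.card * A.card ≤ 2 * W.card := by
    have hsub : A ×ˢ A ⊆ W ∪ W.image Prod.swap := by
      rintro ⟨p, q⟩ hpq
      obtain ⟨hp, hq⟩ := Finset.mem_product.1 hpq
      rw [Finset.mem_union, Finset.mem_image]
      by_cases hb : Before ord p.1.1 q.2.2
      · exact Or.inl (Finset.mem_filter.2 ⟨hpq, hb⟩)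
      -- If z_q ≤ u_p, then u_q < z_q ≤ u_p < z_p.
      · refine Or.inr ⟨(q, p), Finset.mem_filter.2 ⟨Finset.mem_product.2 ⟨hq, hp⟩, ?_⟩, rfl⟩
        have h2 := h.pairs_before p (List.mem_toFinset.1 hp)
        have h3 := h.pairs_before q (List.mem_toFinset.1 hq)
        simp only [Before] at *
        omega
    have h2 := (Finset.card_le_card hsub).trans (Finset.card_union_le _ _)
    rw [Finset.card_product] at h2
    have h3 : (W.image Prod.swap).card ≤ W.card := Finset.card_image_le
    omega
  have h2 : W.card ≤ (relatedPairs ((v, w) :: old) \ relatedPairs old).card := by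
    refine Finset.card_le_card_of_injOn (fun p => (p.2.2, p.1.1)) ?_ ?_
    · rintro ⟨p, q⟩ hpq
      obtain ⟨hpq, hb⟩ := Finset.mem_filter.1 (Finset.mem_coe.1 hpq)
      obtain ⟨hp, hq⟩ := Finset.mem_product.1 hpq
      obtain ⟨hp1, hp2, -⟩ := h.pairs_fst p.1 (List.mem_map_of_mem (List.mem_toFinset.1 hp))
      obtain ⟨hq1, -, hq2, -⟩ := h.pairs_snd q.2 (List.mem_map_of_mem (List.mem_toFinset.1 hq))
      simp only [relatedPairs, Finset.coe_sdiff, Set.mem_sdiff, Finset.mem_coe, Finset.mem_filter,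
        Finset.mem_product, List.mem_toFinset]
      refine ⟨⟨⟨List.mem_cons_of_mem _ hq1, List.mem_cons_of_mem _ hp1⟩, ?_⟩,
        fun h' => hc.topological.not_before h'.2 hb⟩
      -- The path from z_q to v, the new arc, and the path from w to u_p.
      exact ((reflTransGen_cons _ (h.reach_B _ hq2)).tail List.mem_cons_self).trans
        (reflTransGen_cons _ (h.reach_F _ hp2))
    · rintro ⟨p, q⟩ hpq ⟨p', q'⟩ hpq' he
      obtain ⟨hp, hq⟩ := Finset.mem_product.1 (Finset.mem_filter.1 (Finset.mem_coe.1 hpq)).1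
      obtain ⟨hp', hq'⟩ := Finset.mem_product.1 (Finset.mem_filter.1 (Finset.mem_coe.1 hpq')).1
      simp only [Prod.mk.injEq] at he
      exact Prod.ext
        (List.inj_on_of_nodup_map h.nodup_fst (List.mem_toFinset.1 hp) (List.mem_toFinset.1 hp') he.2)
        (List.inj_on_of_nodup_map h.nodup_snd (List.mem_toFinset.1 hq) (List.mem_toFinset.1 hq') he.1)
  have h3 := Finset.card_sdiff_add_card_eq_card (relatedPairs_subset_cons old (v, w))
  rw [hcardA] at h1
  omega

/-! ## Progress -/

theorem exists_select {ε : ℝ} (hε : ε ≤ 1 / 2) (ha : 68 ≤ a) (ord : List V) {P : Finset V}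
    (hP : P ≠ ∅) : ∃ s c, Select ε a ord P s c := by
  obtain ⟨t, ht⟩ : ∃ t : CmpTree P.card, t.SelectsApproxMedian ε a := by
    obtain ⟨k, hk⟩ := Nat.exists_eq_succ_of_ne_zero (Finset.card_ne_zero.2
      (Finset.nonempty_iff_ne_empty.2 hP))
    rw [hk]
    obtain ⟨t, ht⟩ := exists_selectsApproxMedian k
    exact ⟨t, ht.mono hε ha⟩
  refine ⟨_, _, t, fun i => (P.equivFin.symm i : V), ht,
    Subtype.val_injective.comp P.equivFin.symm.injective, ?_, rfl, rfl⟩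
  ext x
  simp only [Finset.mem_image, Finset.mem_univ, true_and]
  exact ⟨by rintro ⟨i, rfl⟩; exact (P.equivFin.symm i).2, fun hx => ⟨P.equivFin ⟨x, hx⟩, by simp⟩⟩

theorem exists_updateForward {ε : ℝ} (hε : ε ≤ 1 / 2) (ha : 68 ≤ a) (ord : List V)
    (st : SearchState V) : ∃ c st', UpdateForward ε a ord st c st' := by
  by_cases hFA : st.FA = ∅
  · by_cases hFP : st.FP = ∅
    · exact ⟨_, _, .kill hFA hFP⟩
    · obtain ⟨s, c, hs⟩ := exists_select hε ha ord hFP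
      exact ⟨_, _, .choose hFA hFP hs⟩
  · exact ⟨_, _, .skip hFA⟩

theorem exists_updateBackward {ε : ℝ} (hε : ε ≤ 1 / 2) (ha : 68 ≤ a) (ord : List V)
    (st : SearchState V) : ∃ c st', UpdateBackward ε a ord st c st' := by
  by_cases hBA : st.BA = ∅
  · by_cases hBP : st.BP = ∅
    · exact ⟨_, _, .kill hBA hBP⟩
    · obtain ⟨s, c, hs⟩ := exists_select hε ha ord hBP
      exact ⟨_, _, .choose hBA hBP hs⟩
  · exact ⟨_, _, .skip hBA⟩

theorem SearchInv.exists_searchStep (h : SearchInv old ord v w st L) (hFA : st.FA ≠ ∅)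
    (hBA : st.BA ≠ ∅) : ∃ r, SearchStep ((v, w) :: old) ord st r := by
  obtain ⟨u, hu⟩ := Finset.nonempty_iff_ne_empty.2 hFA
  obtain ⟨z, hz⟩ := Finset.nonempty_iff_ne_empty.2 hBA
  by_cases huz : Before ord u z
  · obtain ⟨x, os, hout⟩ := List.exists_cons_of_ne_nil (h.FA_spec u hu).2.2
    obtain ⟨y, ins, hin⟩ := List.exists_cons_of_ne_nil (h.BA_spec z hz).2.2
    by_cases hx : x ∈ st.B
    · exact ⟨_, .returnForward hu hz huz hout hin hx⟩
    · by_cases hy : y ∈ st.F ∨ y = x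
      · exact ⟨_, .returnBackward hu hz huz hout hin hx hy⟩
      · exact ⟨_, .traverse hu hz huz hout hin hx hy⟩
  · exact ⟨_, .passive hu hz huz⟩

theorem SearchInv.exists_step {ε : ℝ} (hε : ε ≤ 1 / 2) (ha : 68 ≤ a)
    (hc : SearchContext old ord v w) (h : SearchInv old ord v w st L) :
    ∃ c cfg', Step ε a (.search ((v, w) :: old) ord v w st) c cfg' := by
  by_cases hend : st.FA = ∅ ∨ st.BA = ∅
  · obtain ⟨c, ord', hR⟩ := h.exists_reorder hc
    exact ⟨_, _, .finish hend hR⟩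
  · push Not at hend
    obtain ⟨st₁ | b, hs⟩ := h.exists_searchStep hend.1.ne_empty hend.2.ne_empty
    · obtain ⟨c, st₂, hF⟩ := exists_updateForward hε ha ord st₁
      obtain ⟨d, st₃, hB⟩ := exists_updateBackward hε ha ord st₂
      exact ⟨_, _, .loop hs hF hB⟩
    · exact ⟨_, _, .reportCycle hs⟩

theorem IsTopologicalOrder.canProceed {ε : ℝ} {arcs : List (V × V)}
    (h : IsTopologicalOrder arcs ord) : (Config.idle arcs ord).CanProceed ε a := by
  intro v w hvw hnew
  rcases h.1.before_or_before hvw with hb | hb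
  · exact ⟨_, _, .addForward hvw hnew hb, rfl⟩
  · exact ⟨_, _, .addBackward hvw hnew hb, rfl⟩

/-! ## The invariant of the algorithm -/

/-- `n` arc additions with `S` traversals in total, after `T` steps. -/
def TimeBound (D : ℕ) (arcs : List (V × V)) (T : ℕ) : Prop :=
  ∃ S, T ≤ D * (S + arcs.length) ∧ S * S ≤ arcs.length * (2 * (relatedPairs arcs).card)

/-- Cauchy-Schwarz, one term at a time: (S - nτ)² ≥ 0 gives 2Sτ ≤ Q + nτ² after division by `n`,
which is why `n = 0` is separate. -/
theorem sq_add_le {S n Q Q' τ : ℕ} (hS : S * S ≤ n * Q) (hQ : τ * τ + Q ≤ Q') :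
    (S + τ) * (S + τ) ≤ (n + 1) * Q' := by
  refine le_trans ?_ (Nat.mul_le_mul_left (n + 1) hQ)
  rcases Nat.eq_zero_or_pos n with rfl | hn
  · obtain rfl : S = 0 := by nlinarith
    nlinarith
  · zify at *
    have h1 : 0 ≤ (n : ℤ) * (Q + n * τ ^ 2 - 2 * S * τ) := by nlinarith [sq_nonneg ((S : ℤ) - n * τ)]
    have h2 : 0 ≤ (Q : ℤ) + n * τ ^ 2 - 2 * S * τ := nonneg_of_mul_nonneg_right h1 hn
    nlinarith

/-- The steps per arc addition and per traversal. -/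
def timeFactor (K a : ℕ) : ℕ := searchFactor K a + 24

/-- The invariant of the algorithm, `T` being the time used so far. -/
def Config.Good (K a : ℕ) (T : ℕ) : Config V → Prop
  | .idle arcs ord => arcs.Nodup ∧ IsTopologicalOrder arcs ord ∧ TimeBound (timeFactor K a) arcs T
  | .search arcs ord v w st => ∃ old L cost T₀, arcs = (v, w) :: old ∧
      SearchContext old ord v w ∧ SearchGood K a old ord v w st L cost ∧
      TimeBound (timeFactor K a) old T₀ ∧ T = T₀ + 1 + cost
  | .cycle arcs v w b => (Config.cycle arcs v w b).Correct ∧ ∃ S,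
      T ≤ timeFactor K a * (S + 2 * arcs.length) ∧
      S * S ≤ 2 * (arcs.length * arcs.length * arcs.length)

theorem TimeBound.le {D : ℕ} {arcs : List (V × V)} {T : ℕ} (h : TimeBound D arcs T) : ∃ S,
    T ≤ D * (S + arcs.length) ∧ S * S ≤ 2 * (arcs.length * arcs.length * arcs.length) := by
  obtain ⟨S, h1, h2⟩ := h
  refine ⟨S, h1, h2.trans ?_⟩
  have := Nat.mul_le_mul_left arcs.length (card_relatedPairs_le arcs)
  linarith

/-- Only one search can be unfinished or reported, so its traversals are bounded crudely by the
number of old arcs; hence the factor 2. -/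
theorem SearchGood.exists_traversals {T₀ T : ℕ} (h : SearchGood K a old ord v w st L cost)
    (hT : TimeBound (timeFactor K a) old T₀) (hle : T ≤ T₀ + 2 + cost) : ∃ S,
    T ≤ timeFactor K a * (S + 2 * (old.length + 1)) ∧
      S * S ≤ 2 * ((old.length + 1) * (old.length + 1) * (old.length + 1)) := by
  obtain ⟨S, h1, h2⟩ := hT.le
  refine ⟨S, ?_, h2.trans ?_⟩
  · have h3 := h.cost_le
    have h4 := h.inv.length_le
    have h5 : searchFactor K a * (L.length + 1) ≤ searchFactor K a * (old.length + 1) :=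
      Nat.mul_le_mul_left _ (by omega)
    rw [timeFactor] at *
    linarith
  · gcongr <;> omega

theorem Config.Good.step {ε : ℝ} {cfg cfg' : Config V} {T c : ℕ} (hK : 1 ≤ ε * K)
    (hK1 : 1 ≤ K) (h : cfg.Good K a T) (hs : Step ε a cfg c cfg') : cfg'.Good K a (T + c) := by
  cases hs with
  | @addForward arcs ord v w hvw hnew hb =>
    obtain ⟨h1, h2, S, h3, h4⟩ := h
    refine ⟨List.nodup_cons.2 ⟨hnew, h1⟩, ⟨h2.1, fun x y hxy => ?_⟩, S, ?_, ?_⟩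
    · rcases List.mem_cons.1 hxy with e | hxy
      · obtain ⟨rfl, rfl⟩ := Prod.mk.inj e
        exact hb
      · exact h2.2 x y hxy
    · have : 1 ≤ timeFactor K a := by rw [timeFactor]; omega
      rw [List.length_cons]
      linarith
    · have := Finset.card_le_card (relatedPairs_subset_cons arcs (v, w))
      exact sq_add_le (τ := 0) h4 (by omega)
  | @addBackward arcs ord v w hvw hnew hb =>
    obtain ⟨h1, h2, h3⟩ := h
    have hc : SearchContext arcs ord v w := ⟨h1, hnew, h2, hb⟩
    exact ⟨arcs, [], 0, T, rfl, hc, hc.searchGood_init hK1, h3, rfl⟩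
  | loop hs hF hB =>
    obtain ⟨old, L, cost, T₀, rfl, hc, hg, hT, rfl⟩ := h
    obtain ⟨L', hg'⟩ := hg.loop hc hK hs hF hB
    exact ⟨old, L', _, T₀, rfl, hc, hg', hT, by omega⟩
  | @reportCycle arcs ord v w st b hs =>
    obtain ⟨old, L, cost, T₀, rfl, hc, hg, hT, rfl⟩ := h
    exact ⟨⟨old, rfl, hg.inv.report hs⟩, by
      simpa using hg.exists_traversals hT (T := T₀ + 1 + cost + 1) (by omega)⟩
  | @finish arcs ord ord' v w st c hend hR =>
    obtain ⟨old, L, cost, T₀, rfl, hc, hg, ⟨S, h1, h2⟩, rfl⟩ := h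
    obtain ⟨h3, h4⟩ := hg.reorder hc hend hR
    refine ⟨hc.nodup_cons, h3, S + L.length, ?_, ?_⟩
    -- The 24 in `timeFactor` is one step for the addition, one for ending the search and 22 for
    -- reordering.
    · have h5 := hg.cost_le
      rw [List.length_cons]
      rw [timeFactor] at *
      linarith
    · exact sq_add_le h2 (hg.inv.sq_le_relatedPairs hc)

/-! ### Consequences of the invariant along a run -/

theorem Config.Good.of_run {ε : ℝ} {cfg : Config V} {T : ℕ} (hK : 1 ≤ ε * K) (hK1 : 1 ≤ K)
    {ord₀ : List V} (hord : IsTotalOrder ord₀) (h : Run ε a (.idle [] ord₀) T cfg) :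
    cfg.Good K a T := by
  induction h with
  | refl => exact ⟨List.nodup_nil, ⟨hord, fun _ _ h => (List.not_mem_nil h).elim⟩, 0, by simp,
      by simp⟩
  | tail _ hs ih => exact ih.step hK hK1 hs

theorem Config.Good.correct {cfg : Config V} {T : ℕ} (h : cfg.Good K a T) : cfg.Correct := by
  cases cfg with
  | idle arcs ord => exact ⟨h.2.1.acyclic, h.2.1⟩
  | search => trivial
  | cycle => exact h.1

theorem Config.Good.canProceed {ε : ℝ} (hε : ε ≤ 1 / 2) (ha : 68 ≤ a) {cfg : Config V} {T : ℕ}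
    (h : cfg.Good K a T) : cfg.CanProceed ε a := by
  cases cfg with
  | idle arcs ord => exact h.2.1.canProceed
  | search =>
    obtain ⟨old, L, cost, T₀, rfl, hc, hg, -⟩ := h
    exact hg.inv.exists_step hε ha hc
  | cycle => trivial

theorem Config.Good.exists_traversals {cfg : Config V} {T : ℕ} (h : cfg.Good K a T) : ∃ S,
    T ≤ timeFactor K a * (S + 2 * cfg.arcs.length) ∧
      S * S ≤ 2 * (cfg.arcs.length * cfg.arcs.length * cfg.arcs.length) := by
  cases cfg with
  | idle arcs ord =>
    obtain ⟨S, h1, h2⟩ := h.2.2.le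
    exact ⟨S, h1.trans (Nat.mul_le_mul_left _ (by simp only [Config.arcs]; omega)), h2⟩
  | search =>
    obtain ⟨old, L, cost, T₀, rfl, hc, hg, hT, rfl⟩ := h
    simpa [Config.arcs] using hg.exists_traversals hT (T := T₀ + 1 + cost) (by omega)
  | cycle => exact h.2

theorem le_rpow_of_sq_le {D S T m : ℕ} (hT : T ≤ D * (S + 2 * m)) (hS : S * S ≤ 2 * (m * m * m)) :
    (T : ℝ) ≤ 4 * D * (m : ℝ) ^ (3 / 2 : ℝ) := by
  have hm : (0 : ℝ) ≤ m := m.cast_nonneg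
  set q := (m : ℝ) ^ (3 / 2 : ℝ)
  have hq : 0 ≤ q := Real.rpow_nonneg hm _
  have hqq : q * q = (m : ℝ) * m * m := by
    rw [← Real.rpow_add_of_nonneg hm (by norm_num) (by norm_num)]
    norm_num
    ring
  have hmq : (m : ℝ) ≤ q := by
    rcases Nat.eq_zero_or_pos m with rfl | hpos
    · simpa using hq
    · refine abs_le_of_sq_le_sq' ?_ hq |>.2
      have : (1 : ℝ) ≤ m := by exact_mod_cast hpos
      rw [sq, sq, hqq]
      nlinarith [mul_nonneg hm hm]
  have hSq : (S : ℝ) ≤ 2 * q := by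
    refine abs_le_of_sq_le_sq' ?_ (by positivity) |>.2
    have : (S : ℝ) * S ≤ 2 * (m * m * m) := by exact_mod_cast hS
    nlinarith [mul_nonneg hq hq]
  calc (T : ℝ) ≤ D * (S + 2 * m) := by exact_mod_cast hT
    _ ≤ D * (2 * q + 2 * q) := by gcongr
    _ = 4 * D * q := by ring

end Main

end SoftThreshold

theorem mainTheorem1 :
    ∃ a₀ : ℕ,
      (∀ k : ℕ, ∃ t : SoftThreshold.CmpTree (k + 1), t.SelectsApproxMedian (1 / 2) a₀) ∧
      ∀ (ε : ℝ) (a : ℕ), 0 < ε → ε ≤ 1 / 2 → a₀ ≤ a →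
        ∃ C : ℝ, ∀ (n : ℕ) (ord₀ : List (Fin n)), SoftThreshold.IsTotalOrder ord₀ →
          ∀ (T : ℕ) (cfg : SoftThreshold.Config (Fin n)),
            SoftThreshold.Run ε a (SoftThreshold.Config.idle [] ord₀) T cfg →
              (T : ℝ) ≤ C * (cfg.arcs.length : ℝ) ^ (3 / 2 : ℝ) ∧
              cfg.Correct ∧
              cfg.CanProceed ε a := by
  refine ⟨68, SoftThreshold.exists_selectsApproxMedian, fun ε a hε hε' ha => ?_⟩
  -- The constant depends on `ε` only through this integer.
  obtain ⟨K, hK⟩ := exists_nat_ge (1 / ε)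
  have hK' : 1 ≤ ε * K := by rwa [div_le_iff₀' hε] at hK
  have hK1 : 1 ≤ K := by
    rw [Nat.one_le_iff_ne_zero]
    rintro rfl
    norm_num at hK'
  refine ⟨4 * SoftThreshold.timeFactor K a, fun n ord₀ hord T cfg hrun => ?_⟩
  have hgood := SoftThreshold.Config.Good.of_run hK' hK1 hord hrun
  obtain ⟨S, hT, hS⟩ := hgood.exists_traversals
  exact ⟨SoftThreshold.le_rpow_of_sq_le hT hS, hgood.correct, hgood.canProceed hε' ha⟩
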